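/- Let $K$ be a field with a valuation $\operatorname{val}\colon K^\times\to\mathbb R$ with value group $\Gamma$, valuation ring $R$ and residue field $k$, and fix a splitting of the valuation, i.e. a group homomorphism $r\colon\Gamma\to K^\times$ with $\operatorname{val}(r(\gamma))=\gamma$. For a closed subscheme $V\subset\mathbb G_m^N$ with ideal $I\subset K[x_1^{\pm},\dots,x_N^{\pm}]$ and $w\in\mathbb R^N$, let $R[x^{\pm}]^w$ be the $R$-subalgebra of $K[x^\pm]$ generated by the terms $ax^u$ with $\operatorname{val}(a)+w\cdot u\ge 0$, and let $\phi_w\colon R[x^\pm]^w\to k[x^\pm]$ be the ring homomorphism sending $ax^u$ to $\overline{a\,r(w\cdot u)}\,x^u$ if $\operatorname{val}(a)+w\cdot u=0$ and to $0$ if $\operatorname{val}(a)+w\cdot u>0$. The initial degeneration $\operatorname{in}_w(V)$ is the closed subscheme of $\mathbb G_{m,k}^N$ whose ideal is generated by $\phi_w(I\cap R[x^\pm]^w)$, and $\operatorname{Trop}(V)=\{w\in\mathbb R^N:\operatorname{in}_w(V)\neq\emptyset\}$. A Gröbner stratum is a connected component of the set of $w\in\operatorname{Trop}(V)$ for which $\operatorname{in}_w(V)$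 is one fixed subscheme. The topological stratification of $\operatorname{Trop}(V)$ is the finest partition such that, for every linear isomorphism $\mathbb R^N\cong\mathbb R^{N-m}\times\mathbb R^m$ and every open $U\subset\mathbb R^N$ for which $U\cap\operatorname{Trop}(V)$ is the product of a subset of $\mathbb R^{N-m}$ with a connected open $W\subset\mathbb R^m$, the intersection of each stratum with $U$ is also the product of a subset of $\mathbb R^{N-m}$ with $W$. Let $\pi\in K$ with $\operatorname{val}(\pi)=1$, and let $V\subset\mathbb G_m^3$ be the subscheme defined by the ideal $I\subset K[x^\pm,y^\pm,z^\pm]$ generated by the $2\times2$ minors of $$\begin{bmatrix} x-1 & \pi(y-1) & \pi(y-1-\pi z)\\ \pi(y-1) & \pi(y-1-\pi z) & x-1-\pi\end{bmatrix}.$$ Write $X,Y,Z$ for the coordinates on $\mathbb R^3$. Then $V$ is an integral curve, and: 1. $\operatorname{Trop}(V)\cap\{Z>-1\}$ is the open half-ray $\rho=\{X=Y=0,\ Z>-1\}$. 2. $\rho$ is one stratum of the topological stratification of $\operatorname{Trop}(V)$. 3. The Gröbner strata that meet $\rho$ are exactly the three subsets of $\rho$ given by $-1<Z<0$, by $Z=0$,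 and by $Z>0$. 4. The ideal of $\operatorname{in}_{(0,0,Z)}(V)$ in $k[x^\pm,y^\pm,z^\pm]$ is $\langle x-1,(y-1)^2\rangle$ if $-1<Z<0$; $\langle (x-1)^2,(x-1)z-(y-1)\rangle$ if $Z=0$; and $\langle (x-1)^2,y-1\rangle$ if $Z>0$. 5. All these initial degenerations are non-reduced and have the same support, the subtorus $x=y=1$, but the three ideals in (4) are pairwise different. -/

import Mathlib

open scoped Matrix

noncomputable section

namespace TropGrobner

section Valued

variable {K : Type*} [Field K] (v : AddValuation K (WithTop ℝ))

/-- The valuation ring `R = {a | 0 ≤ val a}` of a real-valued valuation. -/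
def valRing : ValuationSubring K where
  carrier := {a | 0 ≤ v a}
  mul_mem' {a b} ha hb := by
    simp only [Set.mem_ofPred_eq, AddValuation.map_mul] at *
    exact add_nonneg ha hb
  one_mem' := by simp
  add_mem' {a b} ha hb := v.map_le_add ha hb
  zero_mem' := by simp
  neg_mem' {a} ha := by simpa [AddValuation.map_neg] using ha
  mem_or_inv_mem' a := by
    by_cases h : 0 ≤ v a
    · exact Or.inl h
    · right
      have ha : a ≠ 0 := by rintro rfl; simp at h
      have h1 : v a + v a⁻¹ = 0 := by
        rw [← v.map_mul, mul_inv_cancel₀ ha, v.map_one]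
      by_contra h2
      have h3 : v a + v a⁻¹ < 0 :=
        lt_of_le_of_lt (add_le_add_right (not_le.mp h2).le _) (by simpa using h)
      exact absurd h1 h3.ne

theorem mem_valRing {a : K} : a ∈ valRing v ↔ 0 ≤ v a := Iff.rfl

/-- The residue field `k = R / 𝔪`. -/
abbrev ResField : Type _ := IsLocalRing.ResidueField (valRing v)

/-- The value group `Γ = val(Kˣ) ⊆ ℝ`. -/
def valueGroup : AddSubgroup ℝ where
  carrier := {γ | ∃ a : Kˣ, v a = (γ : WithTop ℝ)}
  add_mem' := by
    rintro x y ⟨a, ha⟩ ⟨b, hb⟩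
    exact ⟨a * b, by simp [v.map_mul, ha, hb]⟩
  zero_mem' := ⟨1, by simp⟩
  neg_mem' := by
    rintro x ⟨a, ha⟩
    refine ⟨a⁻¹, ?_⟩
    rw [Units.val_inv_eq_inv_val, v.map_inv, ha]
    rfl

/-- A splitting `r : Γ → Kˣ` of the valuation: a group homomorphism with `val (r γ) = γ`. -/
structure Splitting where
  toHom : Multiplicative (valueGroup v) →* Kˣ
  val_toHom : ∀ γ : valueGroup v,
    v (toHom (Multiplicative.ofAdd γ)) = ((γ : ℝ) : WithTop ℝ)

variable {v}

theorem mem_valueGroup_of_add_eq_zero {a : K} {γ : ℝ} (h : v a + (γ : WithTop ℝ) = 0) :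
    γ ∈ valueGroup v := by
  have ha : a ≠ 0 := by rintro rfl; simp at h
  refine ⟨(Units.mk0 a ha)⁻¹, ?_⟩
  have h1 : v a ≠ ⊤ := (AddValuation.ne_top_iff v).mpr ha
  obtain ⟨α, hα⟩ := WithTop.ne_top_iff_exists.mp h1
  rw [← hα] at h
  have h2 : α + γ = 0 := by exact_mod_cast h
  rw [Units.val_inv_eq_inv_val, v.map_inv, Units.val_mk0, ← hα, ← neg_eq_of_add_eq_zero_right h2]
  rfl

/-- The element `r γ` of `K`. -/
def Splitting.elt (r : Splitting v) (γ : valueGroup v) : K := r.toHom (Multiplicative.ofAdd γ)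

theorem Splitting.elt_add (r : Splitting v) (γ δ : valueGroup v) :
    r.elt (γ + δ) = r.elt γ * r.elt δ := by
  simp [Splitting.elt, ofAdd_add]

theorem Splitting.val_mul_elt (r : Splitting v) (γ : valueGroup v) (a : K) :
    v (a * r.elt γ) = v a + ((γ : ℝ) : WithTop ℝ) := by
  rw [v.map_mul, Splitting.elt, r.val_toHom]

open Classical in
/-- For `a` in `K` with `val a + γ ≥ 0`: the residue class of `a · r(γ)` if `val a + γ = 0`
(this forces `γ ∈ Γ`), and `0` if `val a + γ > 0`. -/
def redCoeff (r : Splitting v) (γ : ℝ) (a : K) : ResField v :=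
  if h : v a + (γ : WithTop ℝ) = 0 then
    IsLocalRing.residue (valRing v)
      ⟨a * r.elt ⟨γ, mem_valueGroup_of_add_eq_zero h⟩, by
        rw [mem_valRing, r.val_mul_elt]; exact h.ge⟩
  else 0

theorem redCoeff_of_mem (r : Splitting v) {γ : ℝ} {a : K} (hγ : γ ∈ valueGroup v)
    (h : 0 ≤ v a + (γ : WithTop ℝ)) :
    redCoeff r γ a = IsLocalRing.residue (valRing v)
      ⟨a * r.elt ⟨γ, hγ⟩, by rw [mem_valRing, r.val_mul_elt]; exact h⟩ := by
  by_cases h0 : v a + (γ : WithTop ℝ) = 0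
  · rw [redCoeff, dif_pos h0]
  · rw [redCoeff, dif_neg h0, eq_comm, IsLocalRing.residue_eq_zero_iff,
      IsLocalRing.mem_maximalIdeal, mem_nonunits_iff]
    intro hu
    obtain ⟨b, hb⟩ := hu.exists_right_inv
    have hb' : (a * r.elt ⟨γ, hγ⟩) * (b : K) = 1 := congrArg Subtype.val hb
    have h1 := congrArg v hb'
    rw [v.map_mul, r.val_mul_elt, v.map_one] at h1
    have h2 : 0 ≤ v (b : K) := b.2
    have h3 : 0 < v a + (γ : WithTop ℝ) := lt_of_le_of_ne h (Ne.symm h0)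
    exact absurd h1 (add_pos_of_pos_of_nonneg h3 h2).ne'

theorem redCoeff_of_ne (r : Splitting v) {γ : ℝ} {a : K}
    (h : v a + (γ : WithTop ℝ) ≠ 0) : redCoeff r γ a = 0 := by
  rw [redCoeff, dif_neg h]

theorem redCoeff_of_notMem (r : Splitting v) {γ : ℝ} {a : K} (hγ : γ ∉ valueGroup v) :
    redCoeff r γ a = 0 :=
  redCoeff_of_ne r fun h => hγ (mem_valueGroup_of_add_eq_zero h)

theorem redCoeff_zero (r : Splitting v) (γ : ℝ) : redCoeff r γ 0 = 0 :=
  redCoeff_of_ne r (by simp)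

theorem redCoeff_one (r : Splitting v) : redCoeff r 0 1 = 1 := by
  rw [redCoeff_of_mem r (zero_mem _) (by simp)]
  rw [← map_one (IsLocalRing.residue (valRing v))]
  congr 1
  ext
  have h : r.elt ⟨0, zero_mem _⟩ = 1 := by
    have h0 : (⟨0, zero_mem _⟩ : valueGroup v) = 0 := rfl
    rw [h0, Splitting.elt, ofAdd_zero, map_one, Units.val_one]
  simp [h]

theorem tilt_add {γ : ℝ} {a b : K} (ha : 0 ≤ v a + (γ : WithTop ℝ))
    (hb : 0 ≤ v b + (γ : WithTop ℝ)) : 0 ≤ v (a + b) + (γ : WithTop ℝ) := by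
  rcases v.map_add' a b with h | h
  · exact ha.trans (by gcongr)
  · exact hb.trans (by gcongr)

theorem tilt_mul {γ δ : ℝ} {a b : K} (ha : 0 ≤ v a + (γ : WithTop ℝ))
    (hb : 0 ≤ v b + (δ : WithTop ℝ)) : 0 ≤ v (a * b) + ((γ + δ : ℝ) : WithTop ℝ) := by
  rw [v.map_mul, WithTop.coe_add, add_add_add_comm]
  exact add_nonneg ha hb

theorem redCoeff_add (r : Splitting v) {γ : ℝ} {a b : K} (ha : 0 ≤ v a + (γ : WithTop ℝ))
    (hb : 0 ≤ v b + (γ : WithTop ℝ)) :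
    redCoeff r γ (a + b) = redCoeff r γ a + redCoeff r γ b := by
  by_cases hγ : γ ∈ valueGroup v
  · rw [redCoeff_of_mem r hγ ha, redCoeff_of_mem r hγ hb, redCoeff_of_mem r hγ (tilt_add ha hb),
      ← map_add]
    congr 1
    ext
    simp [add_mul]
  · simp [redCoeff_of_notMem r hγ]

theorem redCoeff_mul (r : Splitting v) {γ δ : ℝ} {a b : K} (ha : 0 ≤ v a + (γ : WithTop ℝ))
    (hb : 0 ≤ v b + (δ : WithTop ℝ)) :
    redCoeff r (γ + δ) (a * b) = redCoeff r γ a * redCoeff r δ b := by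
  have hsplit : v (a * b) + ((γ + δ : ℝ) : WithTop ℝ) =
      (v a + (γ : WithTop ℝ)) + (v b + (δ : WithTop ℝ)) := by
    rw [v.map_mul, WithTop.coe_add, add_add_add_comm]
  by_cases hγ : γ ∈ valueGroup v
  · by_cases hδ : δ ∈ valueGroup v
    · rw [redCoeff_of_mem r hγ ha, redCoeff_of_mem r hδ hb,
        redCoeff_of_mem r (add_mem hγ hδ) (tilt_mul ha hb), ← map_mul]
      congr 1
      ext
      have h := r.elt_add ⟨γ, hγ⟩ ⟨δ, hδ⟩
      simp only [AddMemClass.mk_add_mk] at h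
      simp only [MulMemClass.mk_mul_mk, h]
      ring
    · rw [redCoeff_of_notMem r hδ, mul_zero]
      refine redCoeff_of_ne r ?_
      rw [hsplit]
      have hpos : 0 < v b + (δ : WithTop ℝ) :=
        lt_of_le_of_ne hb fun h => hδ (mem_valueGroup_of_add_eq_zero h.symm)
      exact (hpos.trans_le (le_add_of_nonneg_left ha)).ne'
  · rw [redCoeff_of_notMem r hγ, zero_mul]
    refine redCoeff_of_ne r ?_
    rw [hsplit]
    have hpos : 0 < v a + (γ : WithTop ℝ) :=
      lt_of_le_of_ne ha fun h => hγ (mem_valueGroup_of_add_eq_zero h.symm)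
    exact (add_pos_of_pos_of_nonneg hpos hb).ne'

end Valued

section Laurent

/-- The Laurent polynomial ring `A[x₁^±, …, x_N^±]`, the coordinate ring of the torus `𝔾ₘ^N`;
`AddMonoidAlgebra.single u a` is the term `a x^u`. -/
abbrev Laurent (A : Type*) [CommRing A] (N : ℕ) : Type _ := AddMonoidAlgebra A (Fin N → ℤ)

/-- The coordinate function `x_i`. -/
def coord (A : Type*) [CommRing A] {N : ℕ} (i : Fin N) : Laurent A N :=
  AddMonoidAlgebra.single (Pi.single i 1) 1

/-- The pairing `u · w` of an exponent vector with a weight vector. -/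
def dot {N : ℕ} (w : Fin N → ℝ) (u : Fin N → ℤ) : ℝ := ∑ i, w i * (u i : ℝ)

theorem dot_zero {N : ℕ} (w : Fin N → ℝ) : dot w 0 = 0 := by simp [dot]

theorem dot_add {N : ℕ} (w : Fin N → ℝ) (u u' : Fin N → ℤ) :
    dot w (u + u') = dot w u + dot w u' := by
  simp [dot, mul_add, Finset.sum_add_distrib]

variable {K : Type*} [Field K] (v : AddValuation K (WithTop ℝ)) {N : ℕ}

/-- The `R`-algebra `R[x₁^±, …, x_N^±]^w` generated by all terms `a x^u` with
`val a + u · w ≥ 0`. -/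
def tilted (w : Fin N → ℝ) : Subalgebra (valRing v) (Laurent K N) :=
  Algebra.adjoin (valRing v)
    {f | ∃ (u : Fin N → ℤ) (a : K), 0 ≤ v a + (dot w u : WithTop ℝ) ∧
      f = AddMonoidAlgebra.single u a}

variable {v}

theorem single_mem_tilted {w : Fin N → ℝ} {u : Fin N → ℤ} {a : K}
    (h : 0 ≤ v a + (dot w u : WithTop ℝ)) :
    (AddMonoidAlgebra.single u a : Laurent K N) ∈ tilted v w :=
  Algebra.subset_adjoin ⟨u, a, h, rfl⟩

/-- Every element of `R[x^±]^w` is a finite sum of terms `a x^u` with `val a + u · w ≥ 0`. -/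
theorem tilted_induction {w : Fin N → ℝ} {P : Laurent K N → Prop} (h0 : P 0)
    (hs : ∀ (u : Fin N → ℤ) (a : K), 0 ≤ v a + (dot w u : WithTop ℝ) →
      P (AddMonoidAlgebra.single u a))
    (ha : ∀ f g, f ∈ tilted v w → g ∈ tilted v w → P f → P g → P (f + g))
    {f : Laurent K N} (hf : f ∈ tilted v w) : P f := by
  let M : AddSubmonoid (Laurent K N) := AddSubmonoid.closure
    {f | ∃ (u : Fin N → ℤ) (a : K), 0 ≤ v a + (dot w u : WithTop ℝ) ∧
      f = AddMonoidAlgebra.single u a}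
  have hMt : ∀ g ∈ M, g ∈ tilted v w := by
    intro g hg
    induction hg using AddSubmonoid.closure_induction with
    | mem x hx => exact Algebra.subset_adjoin hx
    | zero => exact zero_mem _
    | add x y _ _ hx hy => exact add_mem hx hy
  have hmul : ∀ x ∈ M, ∀ y ∈ M, x * y ∈ M := by
    intro x hx y hy
    induction hx using AddSubmonoid.closure_induction with
    | mem x hx =>
      obtain ⟨u, a, hua, rfl⟩ := hx
      induction hy using AddSubmonoid.closure_induction with
      | mem y hy =>
        obtain ⟨u', b, hub, rfl⟩ := hy
        refine AddSubmonoid.subset_closure ⟨u + u', a * b, ?_, ?_⟩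
        · rw [dot_add]; exact tilt_mul hua hub
        · rw [AddMonoidAlgebra.single_mul_single]
      | zero => rw [mul_zero]; exact zero_mem _
      | add y z _ _ hy hz => rw [mul_add]; exact add_mem hy hz
    | zero => rw [zero_mul]; exact zero_mem _
    | add x z _ _ hx hz => rw [add_mul]; exact add_mem hx hz
  have htM : f ∈ M := by
    refine Algebra.adjoin_induction (fun x hx => AddSubmonoid.subset_closure hx) ?_
      (fun x y _ _ hx hy => add_mem hx hy) (fun x y _ _ hx hy => hmul x hx y hy) hf
    intro a
    refine AddSubmonoid.subset_closure ⟨0, (a : K), ?_, ?_⟩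
    · have h : 0 ≤ v (a : K) := a.2
      rw [dot_zero]
      simpa only [WithTop.coe_zero, add_zero] using h
    · rfl
  induction htM using AddSubmonoid.closure_induction with
  | mem x hx => obtain ⟨u, a, h, rfl⟩ := hx; exact hs u a h
  | zero => exact h0
  | add x y hx hy ihx ihy =>
    exact ha x y (hMt x hx) (hMt y hy) (ihx (hMt x hx)) (ihy (hMt y hy))

theorem coeff_of_mem_tilted {w : Fin N → ℝ} {f : Laurent K N} (hf : f ∈ tilted v w)
    (u : Fin N → ℤ) : 0 ≤ v (f.coeff u) + (dot w u : WithTop ℝ) := by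
  classical
  refine tilted_induction (P := fun f => 0 ≤ v (f.coeff u) + (dot w u : WithTop ℝ)) (by simp)
    ?_ ?_ hf
  · intro u' a h
    rw [AddMonoidAlgebra.coeff_single, Finsupp.single_apply]
    split_ifs with hu
    · exact hu ▸ h
    · simp
  · intro f g _ _ hf hg
    exact tilt_add hf hg

/-- The map `a x^u ↦ φ(a x^u)` extended termwise to Laurent polynomials. -/
def initialForm (r : Splitting v) (w : Fin N → ℝ) (f : Laurent K N) : Laurent (ResField v) N :=
  AddMonoidAlgebra.ofCoeff <|
    Finsupp.onFinset f.coeff.support (fun u => redCoeff r (dot w u) (f.coeff u)) fun u hu => by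
      rw [Finsupp.mem_support_iff]
      intro h
      exact hu (by rw [h, redCoeff_zero])

theorem initialForm_coeff (r : Splitting v) (w : Fin N → ℝ) (f : Laurent K N) (u : Fin N → ℤ) :
    (initialForm r w f).coeff u = redCoeff r (dot w u) (f.coeff u) := rfl

theorem initialForm_zero (r : Splitting v) (w : Fin N → ℝ) :
    initialForm r w (0 : Laurent K N) = 0 := by
  ext u
  rw [initialForm_coeff]
  simp [redCoeff_zero]

theorem initialForm_single (r : Splitting v) (w : Fin N → ℝ) (u : Fin N → ℤ) (a : K) :
    initialForm r w (AddMonoidAlgebra.single u a) =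
      AddMonoidAlgebra.single u (redCoeff r (dot w u) a) := by
  classical
  ext u'
  rw [initialForm_coeff, AddMonoidAlgebra.coeff_single, AddMonoidAlgebra.coeff_single,
    Finsupp.single_apply, Finsupp.single_apply]
  split_ifs with h
  · rw [h]
  · exact redCoeff_zero r _

theorem initialForm_add (r : Splitting v) (w : Fin N → ℝ) {f g : Laurent K N}
    (hf : f ∈ tilted v w) (hg : g ∈ tilted v w) :
    initialForm r w (f + g) = initialForm r w f + initialForm r w g := by
  ext u
  rw [AddMonoidAlgebra.coeff_add, Finsupp.add_apply]
  simp only [initialForm_coeff]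
  rw [AddMonoidAlgebra.coeff_add, Finsupp.add_apply]
  exact redCoeff_add r (coeff_of_mem_tilted hf u) (coeff_of_mem_tilted hg u)

theorem initialForm_mul (r : Splitting v) (w : Fin N → ℝ) {f g : Laurent K N}
    (hf : f ∈ tilted v w) (hg : g ∈ tilted v w) :
    initialForm r w (f * g) = initialForm r w f * initialForm r w g := by
  refine tilted_induction
    (P := fun f => initialForm r w (f * g) = initialForm r w f * initialForm r w g)
    (by simp [initialForm_zero]) ?_ ?_ hf
  · intro u a hua
    refine tilted_induction (P := fun g =>
      initialForm r w (AddMonoidAlgebra.single u a * g) =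
        initialForm r w (AddMonoidAlgebra.single u a) * initialForm r w g)
      (by simp [initialForm_zero]) ?_ ?_ hg
    · intro u' b hub
      rw [AddMonoidAlgebra.single_mul_single, initialForm_single, initialForm_single,
        initialForm_single, AddMonoidAlgebra.single_mul_single, dot_add, redCoeff_mul r hua hub]
    · intro f g hf hg ihf ihg
      have h := single_mem_tilted hua
      rw [mul_add, initialForm_add r w (mul_mem h hf) (mul_mem h hg), ihf, ihg,
        initialForm_add r w hf hg, mul_add]
  · intro f f' hf hf' ih ih'
    rw [add_mul, initialForm_add r w (mul_mem hf hg) (mul_mem hf' hg), ih, ih',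
      initialForm_add r w hf hf', add_mul]

/-- The ring homomorphism `φ : R[x^±]^w → k[x^±]` sending a term `a x^u` to the class of
`a r(w · u)` times `x^u` if `val a + w · u = 0`, and to `0` if `val a + w · u > 0`. -/
def phi (r : Splitting v) (w : Fin N → ℝ) : tilted v w →+* Laurent (ResField v) N where
  toFun f := initialForm r w f
  map_one' := by
    have h := initialForm_single r w (0 : Fin N → ℤ) (1 : K)
    rw [dot_zero, redCoeff_one] at h
    exact h
  map_mul' f g := initialForm_mul r w f.2 g.2
  map_zero' := initialForm_zero r w
  map_add' f g := initialForm_add r w f.2 g.2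

/-- The ideal of the initial degeneration `in_w(V)` in `k[x^±]`, for `V` the closed subscheme of
the torus with ideal `I`.  The closure of `V` in `Spec R[x^±]^w` has ideal `I ∩ R[x^±]^w`, and
`in_w(V)` is its scheme-theoretic preimage under the map of spectra induced by `φ`. -/
def initialIdeal (r : Splitting v) (I : Ideal (Laurent K N)) (w : Fin N → ℝ) :
    Ideal (Laurent (ResField v) N) :=
  (I.comap (tilted v w).val).map (phi r w)

/-- The tropicalization: all weights at which the initial degeneration is non-empty. -/
def Trop (r : Splitting v) (I : Ideal (Laurent K N)) : Set (Fin N → ℝ) :=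
  {w | initialIdeal r I w ≠ ⊤}

/-- The Gröbner strata of the tropicalization: the connected components of the non-empty sets
of weights with one fixed (non-empty) initial degeneration. -/
def grobnerStrata (r : Splitting v) (I : Ideal (Laurent K N)) : Set (Set (Fin N → ℝ)) :=
  {S | ∃ w ∈ Trop r I,
    S = connectedComponentIn {w' | initialIdeal r I w' = initialIdeal r I w} w}

end Laurent

section Topological

variable {N : ℕ}

/-- A decomposition of `T ⊆ ℝ^N` into disjoint strata (the classes of `s`) is compatible with
local products if for every linear isomorphism `ℝ^N ≅ ℝ^n × ℝ^m` and every open `U` for which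
`U ∩ T` is the product of a set `A ⊆ ℝ^n` and a connected open set `W ⊆ ℝ^m`, the part in `U` of
each stratum is the product of some subset of `ℝ^n` and `W`. -/
def IsProductCompatible (T : Set (Fin N → ℝ)) (s : Setoid T) : Prop :=
  ∀ (n m : ℕ) (e : (Fin N → ℝ) ≃ₗ[ℝ] (Fin n → ℝ) × (Fin m → ℝ)) (U : Set (Fin N → ℝ))
    (A : Set (Fin n → ℝ)) (W : Set (Fin m → ℝ)),
    IsOpen U → IsOpen W → IsPreconnected W → e '' (U ∩ T) = A ×ˢ W →
    ∀ S ∈ s.classes, ∃ B : Set (Fin n → ℝ), e '' (U ∩ Subtype.val '' S) = B ×ˢ W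

/-- The topological stratification of `T`: the finest decomposition that is compatible with
local products (see `isLeast_topologicalStratification`). -/
def topologicalStratification (T : Set (Fin N → ℝ)) : Setoid T :=
  sInf {s | IsProductCompatible T s}

theorem isProductCompatible_iff (T : Set (Fin N → ℝ)) (s : Setoid T) :
    IsProductCompatible T s ↔
      ∀ (n m : ℕ) (e : (Fin N → ℝ) ≃ₗ[ℝ] (Fin n → ℝ) × (Fin m → ℝ)) (U : Set (Fin N → ℝ))
        (A : Set (Fin n → ℝ)) (W : Set (Fin m → ℝ)),
        IsOpen U → IsOpen W → IsPreconnected W → e '' (U ∩ T) = A ×ˢ W →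
        ∀ p q : T, (p : Fin N → ℝ) ∈ U → (q : Fin N → ℝ) ∈ U → (e p).1 = (e q).1 → s p q := by
  constructor
  · intro h n m e U A W hU hW hWc hA p q hp hq hpq
    obtain ⟨B, hB⟩ := h n m e U A W hU hW hWc hA _ (s.mem_classes q)
    have hq' : e q ∈ B ×ˢ W := by
      rw [← hB]
      exact ⟨q, ⟨hq, q, s.refl q, rfl⟩, rfl⟩
    have hpW : (e p).2 ∈ W := by
      have : e p ∈ A ×ˢ W := by rw [← hA]; exact ⟨p, ⟨hp, p.2⟩, rfl⟩
      exact this.2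
    have hp' : e p ∈ B ×ˢ W := ⟨by rw [hpq]; exact hq'.1, hpW⟩
    rw [← hB] at hp'
    obtain ⟨x, ⟨_, y, hy, hyx⟩, hx⟩ := hp'
    have h1 : y = p := Subtype.ext (hyx.trans (e.injective hx))
    rw [← h1]
    exact hy
  · intro h n m e U A W hU hW hWc hA S hS
    obtain ⟨q, rfl⟩ := hS
    refine ⟨Prod.fst '' (e '' (U ∩ Subtype.val '' {x | s x q})), ?_⟩
    ext z
    constructor
    · rintro ⟨x, ⟨hxU, y, hy, rfl⟩, rfl⟩
      refine ⟨⟨_, ⟨y, ⟨hxU, y, hy, rfl⟩, rfl⟩, rfl⟩, ?_⟩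
      have : e y ∈ A ×ˢ W := by rw [← hA]; exact ⟨y, ⟨hxU, y.2⟩, rfl⟩
      exact this.2
    · rintro ⟨⟨_, ⟨x, ⟨hxU, y, hy, rfl⟩, rfl⟩, hz1⟩, hz2⟩
      have hyA : e y ∈ A ×ˢ W := by rw [← hA]; exact ⟨y, ⟨hxU, y.2⟩, rfl⟩
      have hzA : z ∈ e '' (U ∩ T) := by
        rw [hA]
        exact ⟨by rw [← hz1]; exact hyA.1, hz2⟩
      obtain ⟨x, ⟨hxU', hxT⟩, rfl⟩ := hzA
      exact ⟨x, ⟨hxU', ⟨x, hxT⟩,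
        s.trans (h n m e U A W hU hW hWc hA ⟨x, hxT⟩ y hxU' hxU hz1.symm) hy, rfl⟩, rfl⟩

theorem isLeast_topologicalStratification (T : Set (Fin N → ℝ)) :
    IsLeast {s | IsProductCompatible T s} (topologicalStratification T) := by
  refine ⟨?_, fun s hs => sInf_le hs⟩
  rw [Set.mem_ofPred_eq, isProductCompatible_iff]
  intro n m e U A W hU hW hWc hA p q hp hq hpq s hs
  exact (isProductCompatible_iff T s).mp hs n m e U A W hU hW hWc hA p q hp hq hpq

/-- The topological strata of `T`, as subsets of `ℝ^N`. -/
def topologicalStrata (T : Set (Fin N → ℝ)) : Set (Set (Fin N → ℝ)) :=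
  {S | ∃ C ∈ (topologicalStratification T).classes, S = Subtype.val '' C}

end Topological

section Curve

variable {K : Type*} [Field K]

/-- The matrix whose minors cut out the curve. -/
def curveMatrix (π : K) : Matrix (Fin 2) (Fin 3) (Laurent K 3) :=
  let x : Laurent K 3 := coord K 0
  let y : Laurent K 3 := coord K 1
  let z : Laurent K 3 := coord K 2
  let p : Laurent K 3 := algebraMap K (Laurent K 3) π
  !![x - 1, p * (y - 1), p * (y - 1 - p * z);
     p * (y - 1), p * (y - 1 - p * z), x - 1 - p]

/-- The ideal of `V ⊆ 𝔾ₘ³`, generated by the `2 × 2` minors of the matrix. -/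
def curveIdeal (π : K) : Ideal (Laurent K 3) :=
  Ideal.span {d | ∃ c : Fin 2 ↪o Fin 3, d = ((curveMatrix π).submatrix id c).det}

end Curve

end TropGrobner

end

/-! The matrix has the shape `[a b c; b c d]` with `a - d = π`, so `V` is a hyperplane section of
the cone over the twisted cubic. Putting `(a, b, c, d)` proportional to `(1, τ, τ², τ³)` and `e = 1
/ (1 - τ³)` gives `x = 1 + πe`, `y = 1 + τe`, `πz = τ(1 - τ)e`. Hence the coordinate ring of `V` is
`K[τ]` with `removedPoly` inverted (`exists_curveRing_ringEquiv`), a one-dimensional domain.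

Two branches of the curve lie over the ray `ρ`, one at `τ = 0` and one at `τ = ∞`. In a suitable
local parameter they have the same `z`, with `πz` equal to the parameter to first order, and their
`(x, y)` differ to first order by `(π, τ)`, which is about `π(1, z)`. They therefore collide to a
double structure on `x = y = 1` whose normal direction is the limit of `(1, z)`: it is `(0, 1)` if
`Z < 0`, `(1, z)` if `Z = 0`, and `(1, 0)` if `Z > 0`.

The initial ideals are found by two inclusions. Explicit elements of `I`, obtained from the minors
by elimination and by dividing out `π` (`linear_relation_mem`, `y_equation_mem`, `x_equation_mem`),
reduce to the stated generators, or to a unit off `ρ`. Conversely, let `f` lie in `I` and in the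
tilted algebra. Expanding `f` along both branches (`exists_branches`) and estimating each power
series coefficient (`lt_val_sum_of_deviation`) shows that the initial form vanishes on `x = y = 1`
(`lt_val_zSum_one`), as does its derivative in the limiting direction (`lt_val_zSum_add`). By a
first-order Taylor expansion (`sub_zProj_mem`) this puts it in the stated ideal.

Dual-number points distinguish the three ideals. For the strata, each Gröbner piece is clopen in its
locus (`connectedComponentIn_eq_of_clopen`), and the two-part partition into `ρ` and its complement
is product compatible (`mem_openRay_of_mem_fiber`), which bounds the topological stratum from above.
-/

open scoped Matrix

noncomputable section

namespace TropGrobner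

/-! ### Evaluation of Laurent polynomials at units. -/

section LaurentEval

variable {A : Type*} [CommRing A] {N : ℕ} {B : Type*} [CommRing B] [Algebra A B]

/-- Evaluation of Laurent polynomials at a tuple of units. -/
def laurentEval (t : Fin N → Bˣ) : Laurent A N →ₐ[A] B :=
  AddMonoidAlgebra.lift A B (Fin N → ℤ)
    { toFun := fun u => ((∏ i, t i ^ (Multiplicative.toAdd u i) : Bˣ) : B)
      map_one' := by simp
      map_mul' := fun u u' => by simp [zpow_add, Finset.prod_mul_distrib] }

theorem laurentEval_single (t : Fin N → Bˣ) (u : Fin N → ℤ) (a : A) :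
    laurentEval t (AddMonoidAlgebra.single u a) = a • ((∏ i, t i ^ u i : Bˣ) : B) := by
  rw [laurentEval, AddMonoidAlgebra.lift_single]
  rfl

theorem laurentEval_coord (t : Fin N → Bˣ) (i : Fin N) :
    laurentEval t (coord A i) = t i := by
  classical
  rw [coord, laurentEval_single, one_smul]
  congr 1
  rw [Finset.prod_eq_single i] <;> simp +contextual

variable (A) in
/-- The coordinate function `x_i` as a unit. -/
def coordUnit (i : Fin N) : (Laurent A N)ˣ where
  val := coord A i
  inv := AddMonoidAlgebra.single (Pi.single i (-1)) 1
  val_inv := by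
    rw [coord, AddMonoidAlgebra.single_mul_single, ← Pi.single_add]
    simp [AddMonoidAlgebra.one_def]
  inv_val := by
    rw [coord, AddMonoidAlgebra.single_mul_single, ← Pi.single_add]
    simp [AddMonoidAlgebra.one_def]

theorem coordUnit_val (i : Fin N) : (coordUnit A i : Laurent A N) = coord A i := rfl

theorem coordUnit_zpow (i : Fin N) (n : ℤ) :
    ((coordUnit A i ^ n : (Laurent A N)ˣ) : Laurent A N) =
      AddMonoidAlgebra.single (Pi.single i n) 1 := by
  induction n using Int.induction_on with
  | zero => simp [AddMonoidAlgebra.one_def]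
  | succ n ih =>
    rw [zpow_add_one, Units.val_mul, ih, coordUnit_val, coord,
      AddMonoidAlgebra.single_mul_single, ← Pi.single_add, mul_one]
  | pred n ih =>
    rw [zpow_sub_one, Units.val_mul, ih, sub_eq_add_neg, Pi.single_add]
    change _ * AddMonoidAlgebra.single (Pi.single i (-1)) 1 = _
    rw [AddMonoidAlgebra.single_mul_single, mul_one]

theorem prod_coordUnit_zpow (u : Fin N → ℤ) :
    ((∏ i, coordUnit A i ^ u i : (Laurent A N)ˣ) : Laurent A N) =
      AddMonoidAlgebra.single u 1 := by
  rw [Units.coe_prod]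
  simp_rw [coordUnit_zpow]
  have h : ∀ s : Finset (Fin N),
      ∏ i ∈ s, (AddMonoidAlgebra.single (Pi.single i (u i)) 1 : Laurent A N) = AddMonoidAlgebra.single (∑ i ∈ s, Pi.single i (u i)) 1 := by
    classical
    intro s
    induction s using Finset.induction_on with
    | empty => simp [AddMonoidAlgebra.one_def]
    | insert i s hi ih =>
      rw [Finset.prod_insert hi, ih, Finset.sum_insert hi, AddMonoidAlgebra.single_mul_single,
        mul_one]
  rw [h, Finset.univ_sum_single]

theorem laurent_algHom_ext {f g : Laurent A N →ₐ[A] B}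
    (h : ∀ i, f (coord A i) = g (coord A i)) : f = g := by
  refine AddMonoidAlgebra.algHom_ext (fun u => ?_) ?_
  · rw [← prod_coordUnit_zpow]
    have h' : ∀ i, Units.map (f : Laurent A N →* B) (coordUnit A i) =
        Units.map (g : Laurent A N →* B) (coordUnit A i) := fun i => Units.ext (h i)
    have h2 : Units.map (f : Laurent A N →* B) (∏ i, coordUnit A i ^ u i) =
        Units.map (g : Laurent A N →* B) (∏ i, coordUnit A i ^ u i) := by
      simp only [map_prod, map_zpow, h']
    exact congrArg Units.val h2
  · ext

end LaurentEval

/-! ### Relations on the curve obtained from the minors. -/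

section Curve

variable {K : Type*} [Field K]

theorem det_submatrix_two {B : Type*} [CommRing B] (M : Matrix (Fin 2) (Fin 3) B)
    (c : Fin 2 → Fin 3) :
    (M.submatrix id c).det = M 0 (c 0) * M 1 (c 1) - M 0 (c 1) * M 1 (c 0) := by
  rw [Matrix.det_fin_two]
  rfl

theorem minor_mem_curveIdeal (π : K) {i j : Fin 3} (hij : i < j) :
    curveMatrix π 0 i * curveMatrix π 1 j - curveMatrix π 0 j * curveMatrix π 1 i ∈
      curveIdeal π := by
  refine Ideal.subset_span ⟨OrderEmbedding.ofStrictMono ![i, j] ?_, ?_⟩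
  · intro a b hab
    fin_cases a <;> fin_cases b <;> simp_all
  · rw [det_submatrix_two]
    rfl

theorem curveIdeal_le_iff (π : K) (J : Ideal (Laurent K 3)) :
    curveIdeal π ≤ J ↔ ∀ i j : Fin 3, i < j →
      curveMatrix π 0 i * curveMatrix π 1 j - curveMatrix π 0 j * curveMatrix π 1 i ∈ J := by
  constructor
  · intro h i j hij
    exact h (minor_mem_curveIdeal π hij)
  · intro h
    rw [curveIdeal, Ideal.span_le]
    rintro _ ⟨c, rfl⟩
    rw [det_submatrix_two]
    exact h _ _ (c.strictMono (by decide))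

/-- The generators of the curve ideal in terms of `x`, `y`, `z` and `p = π`. -/
theorem curveIdeal_le_ker {B : Type*} [CommRing B] {π : K} {F : Laurent K 3 →+* B} {x y z p : B}
    (hx : F (coord K 0) = x) (hy : F (coord K 1) = y) (hz : F (coord K 2) = z)
    (hp : F (algebraMap K _ π) = p)
    (h01 : (x - 1) * (p * (y - 1 - p * z)) = (p * (y - 1)) * (p * (y - 1)))
    (h02 : (x - 1) * (x - 1 - p) = (p * (y - 1 - p * z)) * (p * (y - 1)))
    (h12 : (p * (y - 1)) * (x - 1 - p) = (p * (y - 1 - p * z)) * (p * (y - 1 - p * z))) :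
    curveIdeal π ≤ RingHom.ker F := by
  rw [curveIdeal_le_iff]
  intro i j hij
  rw [RingHom.mem_ker]
  have : (i = 0 ∧ j = 1) ∨ (i = 0 ∧ j = 2) ∨ (i = 1 ∧ j = 2) := by omega
  rcases this with ⟨rfl, rfl⟩ | ⟨rfl, rfl⟩ | ⟨rfl, rfl⟩ <;>
    simp only [curveMatrix, Matrix.of_apply, Matrix.cons_val, map_sub, map_mul, map_one, hx, hy,
      hz, hp, sub_eq_zero] <;> assumption

/-- The constant `a` as a Laurent polynomial in three variables. -/
abbrev cst (a : K) : Laurent K 3 := algebraMap K (Laurent K 3) a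

section Relations

variable {π : K}

theorem mem_of_p_mul_mem (hπ : π ≠ 0) {I : Ideal (Laurent K 3)} {f : Laurent K 3}
    (h : cst π * f ∈ I) :
    f ∈ I := by
  have hu : IsUnit (cst π) := (IsUnit.mk0 π hπ).map _
  exact (Ideal.unit_mul_mem_iff_mem I hu).mp h

theorem x_quadric_mem :
    (coord K 0 - 1) * (coord K 0 - 1 - cst π) -
      cst π ^ 2 * (coord K 1 - 1) * (coord K 1 - 1 - cst π * coord K 2) ∈ curveIdeal π := by
  convert minor_mem_curveIdeal π (show (0 : Fin 3) < 2 by decide) using 1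
  simp only [curveMatrix, Matrix.of_apply, Matrix.cons_val]
  ring

theorem xy_quadric_mem (hπ : π ≠ 0) :
    (coord K 0 - 1) * (coord K 1 - 1 - cst π * coord K 2) -
      cst π * (coord K 1 - 1) ^ 2 ∈ curveIdeal π := by
  apply mem_of_p_mul_mem hπ
  convert minor_mem_curveIdeal π (show (0 : Fin 3) < 1 by decide) using 1
  simp only [curveMatrix, Matrix.of_apply, Matrix.cons_val]
  ring

theorem xyz_quadric_mem (hπ : π ≠ 0) :
    (coord K 1 - 1) * (coord K 0 - 1 - cst π) -
      cst π * (coord K 1 - 1 - cst π * coord K 2) ^ 2 ∈ curveIdeal π := by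
  apply mem_of_p_mul_mem hπ
  convert minor_mem_curveIdeal π (show (1 : Fin 3) < 2 by decide) using 1
  simp only [curveMatrix, Matrix.of_apply, Matrix.cons_val]
  ring

/-- Two of the minors divided by `π` agree modulo `π`, so their difference can be divided by `π`
once more. The result reduces to `(y - 1) - z(x - 1)` when `πz` reduces to `0`, which is how the
direction `(1, z)` enters. -/
theorem linear_relation_mem (hπ : π ≠ 0) :
    (coord K 1 - 1) - coord K 2 * (coord K 0 - 1) - 2 * (cst π * coord K 2) * (coord K 1 - 1) +
      (cst π * coord K 2) ^ 2 ∈ curveIdeal π := by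
  apply mem_of_p_mul_mem hπ
  convert sub_mem (xy_quadric_mem hπ) (xyz_quadric_mem hπ) using 1
  ring

/-- Elimination of `x`: the term `z(x - 1)(y - 1 - πz)` cancels between the two relations. This is
the quadratic equation of `y - 1` over the `z`-line. -/
theorem y_equation_mem (hπ : π ≠ 0) :
    (1 - 3 * (cst π * coord K 2)) * ((coord K 1 - 1) ^ 2 - cst π * coord K 2 * (coord K 1 - 1)) -
      (cst π * coord K 2) ^ 3 ∈ curveIdeal π := by
  convert add_mem (Ideal.mul_mem_left _ (coord K 2) (xy_quadric_mem hπ))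
    (Ideal.mul_mem_left _ (coord K 1 - 1 - cst π * coord K 2)
      (linear_relation_mem hπ)) using 1
  ring

/-- Elimination of `y`, using that the minor in `x` contains `y` only through `(y - 1)(y - 1 - πz)`.
-/
theorem x_equation_mem (hπ : π ≠ 0) :
    (1 - 3 * (cst π * coord K 2)) * ((coord K 0 - 1) * (coord K 0 - 1 - cst π)) -
      cst π ^ 2 * (cst π * coord K 2) ^ 3 ∈ curveIdeal π := by
  convert add_mem (Ideal.mul_mem_left _ (1 - 3 * (cst π * coord K 2))
      x_quadric_mem)
    (Ideal.mul_mem_left _ (cst π ^ 2) (y_equation_mem hπ)) using 1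
  ring

end Relations

end Curve

/-! ### The rational parametrization; the curve is integral of dimension one. -/

section Integral

open Polynomial

theorem isPrincipalIdealRing_of_isLocalization {R : Type*} [CommRing R] [IsPrincipalIdealRing R]
    (M : Submonoid R) (S : Type*) [CommRing S] [Algebra R S] [IsLocalization M S] :
    IsPrincipalIdealRing S := by
  refine ⟨fun J => ⟨?_⟩⟩
  obtain ⟨a, ha⟩ := (IsPrincipalIdealRing.principal (J.under R)).principal
  refine ⟨algebraMap R S a, ?_⟩
  rw [← IsLocalization.map_under M S J, ha]
  simp only [Ideal.submodule_span_eq, Ideal.map_span, Set.image_singleton]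

variable {K : Type*} [Field K]

/-- The polynomial whose zeros have to be removed from the line to obtain the curve. -/
def removedPoly (π : K) : K[X] :=
  X * (1 - X ^ 3) * (1 + C π - X ^ 3) * (1 + X - X ^ 3)

/-- The coordinate ring of the line without the zeros of `removedPoly`. -/
abbrev CurveRing (π : K) : Type _ := Localization.Away (removedPoly π)

/-- The ring is a localization of a principal ideal domain. It is not a field, because evaluation at
`t` extends to it and kills the nonzero element `X - t`. -/
theorem ringKrullDim_curveRing {π t : K} (ht : (removedPoly π).eval t ≠ 0) :
    IsDomain (CurveRing π) ∧ ringKrullDim (CurveRing π) = 1 := by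
  have h0 : removedPoly π ≠ 0 := by rintro h; simp [h] at ht
  have hle : Submonoid.powers (removedPoly π) ≤ nonZeroDivisors K[X] :=
    powers_le_nonZeroDivisors_of_noZeroDivisors h0
  have hdom : IsDomain (CurveRing π) := IsLocalization.isDomain_localization hle
  have hpid : IsPrincipalIdealRing (CurveRing π) :=
    isPrincipalIdealRing_of_isLocalization (Submonoid.powers (removedPoly π)) _
  refine ⟨hdom, IsPrincipalIdealRing.ringKrullDim_eq_one _ fun hf => ?_⟩
  have hu : IsUnit ((evalRingHom t) (removedPoly π)) := by
    simpa using ht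
  let F : CurveRing π →+* K := IsLocalization.Away.lift (removedPoly π) hu
  have hinj : Function.Injective F := by
    let := hf.toField
    exact F.injective
  have h1 : F (algebraMap K[X] _ (X - C t)) = 0 := by
    rw [IsLocalization.Away.lift_eq]
    simp
  have h2 : algebraMap K[X] (CurveRing π) (X - C t) = algebraMap K[X] (CurveRing π) 0 := by
    apply hinj
    rw [h1, map_zero, map_zero]
  exact X_sub_C_ne_zero t (IsLocalization.injective _ hle h2)

variable {π : K}

/-- The relations of the curve at a point of parameter `τ`, where `e = 1 / (1 - τ ^ 3)`. -/
theorem curveIdeal_le_ker_of_parameter {B : Type*} [CommRing B] {F : Laurent K 3 →+* B}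
    {p τ e : B} (he : e * (1 - τ ^ 3) = 1) (hx : F (coord K 0) = 1 + p * e)
    (hy : F (coord K 1) = 1 + τ * e) (hz : p * F (coord K 2) = τ * (1 - τ) * e)
    (hp : F (algebraMap K _ π) = p) : curveIdeal π ≤ RingHom.ker F := by
  have h3 : e * τ ^ 3 = e - 1 := by linear_combination -he
  refine curveIdeal_le_ker hx hy rfl hp ?_ ?_ ?_ <;> rw [hz]
  · ring
  · linear_combination (-p ^ 2 * e) * h3
  · linear_combination (-p ^ 2 * e * τ) * h3

/-- The relations of the curve at the point of parameter `1 / τ`, where `e = 1 / (1 - τ ^ 3)`. -/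
theorem curveIdeal_le_ker_of_inv_parameter {B : Type*} [CommRing B] {F : Laurent K 3 →+* B}
    {p τ e : B} (he : e * (1 - τ ^ 3) = 1) (hx : F (coord K 0) = 1 - p * τ ^ 3 * e)
    (hy : F (coord K 1) = 1 - τ ^ 2 * e) (hz : p * F (coord K 2) = τ * (1 - τ) * e)
    (hp : F (algebraMap K _ π) = p) : curveIdeal π ≤ RingHom.ker F := by
  have h3 : e * τ ^ 3 = e - 1 := by linear_combination -he
  refine curveIdeal_le_ker hx hy rfl hp ?_ ?_ ?_ <;> rw [hz]
  · ring
  · linear_combination (p ^ 2 * e * τ ^ 3) * h3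
  · linear_combination (p ^ 2 * e * τ ^ 2) * h3

/-- The inverse of the parametrization is `τ = π(y - 1) / (x - 1)`. The factors of `removedPoly` are
what must be invertible for `x`, `y`, `z` and `e` to be units; `1 - τ` is covered as a divisor of `1
- τ³`. -/
theorem exists_curveRing_ringEquiv (hπ : π ≠ 0) :
    Nonempty (Laurent K 3 ⧸ curveIdeal π ≃+* CurveRing π) := by
  -- the parametrization
  let L := CurveRing π
  let τ : L := algebraMap K[X] L X
  let p : L := algebraMap K L π
  have hpC : algebraMap K[X] L (C π) = p := by
    rw [← Polynomial.algebraMap_eq, ← IsScalarTower.algebraMap_apply]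
  have hpu : IsUnit p := (IsUnit.mk0 π hπ).map _
  have hh : IsUnit (algebraMap K[X] L (removedPoly π)) :=
    IsLocalization.Away.algebraMap_isUnit _
  have hh' : IsUnit (τ * (1 - τ ^ 3) * (1 + p - τ ^ 3) * (1 + τ - τ ^ 3)) := by
    have : algebraMap K[X] L (removedPoly π) =
        τ * (1 - τ ^ 3) * (1 + p - τ ^ 3) * (1 + τ - τ ^ 3) := by
      simp only [removedPoly, map_mul, map_sub, map_add, map_pow, map_one, hpC, τ]
    rwa [this] at hh
  simp only [IsUnit.mul_iff] at hh'
  obtain ⟨⟨⟨hτ, hc⟩, hx⟩, hy⟩ := hh'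
  obtain ⟨e, he⟩ := hc.exists_left_inv
  have heu : IsUnit e := IsUnit.of_mul_eq_one _ he
  obtain ⟨p', hp'⟩ := hpu.exists_right_inv
  have hp'u : IsUnit p' := IsUnit.of_mul_eq_one_right _ hp'
  have hτ1 : IsUnit (1 - τ) := isUnit_of_dvd_unit ⟨1 + τ + τ ^ 2, by ring⟩ hc
  have hxu : IsUnit (1 + p * e) := by
    have : 1 + p * e = e * (1 + p - τ ^ 3) := by linear_combination -he
    rw [this]; exact heu.mul hx
  have hyu : IsUnit (1 + τ * e) := by
    have : 1 + τ * e = e * (1 + τ - τ ^ 3) := by linear_combination -he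
    rw [this]; exact heu.mul hy
  have hzu : IsUnit (p' * (τ * (1 - τ) * e)) := hp'u.mul ((hτ.mul hτ1).mul heu)
  let φ : Laurent K 3 →ₐ[K] L := laurentEval ![hxu.unit, hyu.unit, hzu.unit]
  have φx : φ (coord K 0) = 1 + p * e := laurentEval_coord _ _
  have φy : φ (coord K 1) = 1 + τ * e := laurentEval_coord _ _
  have φz : φ (coord K 2) = p' * (τ * (1 - τ) * e) := laurentEval_coord _ _
  have hker : curveIdeal π ≤ RingHom.ker (φ : Laurent K 3 →+* L) :=
    curveIdeal_le_ker_of_parameter (p := p) (τ := τ) (e := e) he φx φy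
      (by rw [RingHom.coe_coe, φz, ← mul_assoc, hp', one_mul]) (φ.commutes π)
  let Φ : Laurent K 3 ⧸ curveIdeal π →ₐ[K] L := Ideal.Quotient.liftₐ _ φ hker
  -- the inverse
  let A := Laurent K 3 ⧸ curveIdeal π
  let q : Laurent K 3 →ₐ[K] A := Ideal.Quotient.mkₐ K (curveIdeal π)
  have hq : ∀ f, Φ (q f) = φ f := fun f => rfl
  let P : A := algebraMap K A π
  have hqP : q (cst π) = P := q.commutes π
  have hPu : IsUnit P := (IsUnit.mk0 π hπ).map _
  have hu : ∀ i, IsUnit (q (coord K i)) := fun i => (coordUnit K i).isUnit.map q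
  have key : ∀ {f}, f ∈ curveIdeal π → q f = 0 := fun hf => Ideal.Quotient.eq_zero_iff_mem.mpr hf
  have h1 := key (xy_quadric_mem hπ)
  have h2 := key (x_quadric_mem (π := π))
  have h3 := key (x_equation_mem hπ)
  simp only [map_sub, map_mul, map_pow, map_one, map_ofNat, hqP] at h1 h2 h3
  set x := q (coord K 0)
  set y := q (coord K 1)
  set z := q (coord K 2)
  -- By the equation for `x`, the element `x - 1` divides the unit `π²(πz)³`, so the parameter is
  -- defined on all of `V`.
  have hα : IsUnit (x - 1) := by
    refine isUnit_of_dvd_unit ⟨(1 - 3 * (P * z)) * (x - 1 - P), ?_⟩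
      ((hPu.pow 2).mul ((hPu.mul (hu 2)).pow 3))
    linear_combination -h3
  obtain ⟨i, hi⟩ := hα.exists_right_inv
  obtain ⟨P', hP'⟩ := hPu.exists_right_inv
  have hiu : IsUnit i := IsUnit.of_mul_eq_one_right _ hi
  set t : A := P * (y - 1) * i with ht
  -- On the twisted cubic `τ³ = d / a = (x - 1 - π) / (x - 1)`.
  have ht3 : 1 - t ^ 3 = P * i := by
    have hi3 : (x - 1) ^ 3 * i ^ 3 = 1 := by rw [← mul_pow, hi, one_pow]
    have hi2 : (x - 1) ^ 2 * i ^ 2 = 1 := by rw [← mul_pow, hi, one_pow]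
    rw [ht]
    linear_combination (-1 : A) * hi3 + P * i * hi2 +
      i ^ 3 * ((x - 1) * h2 + P ^ 2 * (y - 1) * h1)
  have ht3u : IsUnit (1 - t ^ 3) := by rw [ht3]; exact hPu.mul hiu
  have hrx : 1 + P - t ^ 3 = x * (1 - t ^ 3) := by
    rw [ht3]
    linear_combination ht3 - P * hi
  have hry : 1 + t - t ^ 3 = y * (1 - t ^ 3) := by
    rw [ht3, ht]
    linear_combination ht3
  have hrz : z * (P * (1 - t ^ 3)) = t * (1 - t) := by
    rw [ht3, ht]
    linear_combination (-i ^ 2) * P * h1 + (-P ^ 2 * z * i + P * (y - 1) * i) * hi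
  have htu : IsUnit t := isUnit_of_mul_isUnit_left (hrz ▸ (hu 2).mul (hPu.mul ht3u))
  have hg : IsUnit (aeval t (removedPoly π)) := by
    simp only [removedPoly, map_mul, map_sub, map_add, map_pow, map_one, aeval_X, aeval_C]
    refine ((htu.mul ht3u).mul ?_).mul ?_
    · rw [show algebraMap K A π = P from rfl, hrx]; exact (hu 0).mul ht3u
    · rw [hry]; exact (hu 1).mul ht3u
  let Ψ : L →ₐ[K] A := IsLocalization.liftAlgHom (M := Submonoid.powers (removedPoly π))
    (f := aeval t) (by
      rintro ⟨_, n, rfl⟩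
      simpa using hg.pow n)
  have hΨτ : Ψ τ = t := by
    simp [Ψ, τ]
  have hΨp : Ψ p = P := Ψ.commutes π
  have hΨe : Ψ e * (1 - t ^ 3) = 1 := by
    rw [← hΨτ, ← map_one Ψ, ← map_pow, ← map_sub, ← map_mul, he]
  have hΨp' : P * Ψ p' = 1 := by
    rw [← hΨp, ← map_mul, hp', map_one]
  have hΨΦ : (Ψ.comp Φ).comp q = (AlgHom.id K A).comp q := by
    refine laurent_algHom_ext fun i => ?_
    change Ψ (φ (coord K i)) = q (coord K i)
    have hc' := ht3u.mul_left_injective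
    fin_cases i
    · change Ψ (φ (coord K 0)) = x
      rw [φx, map_add, map_mul, map_one, hΨp]
      apply hc'
      linear_combination P * hΨe + hrx
    · change Ψ (φ (coord K 1)) = y
      rw [φy, map_add, map_mul, map_one, hΨτ]
      apply hc'
      linear_combination t * hΨe + hry
    · change Ψ (φ (coord K 2)) = z
      rw [φz, map_mul, map_mul, map_mul, map_sub, map_one, hΨτ]
      apply hc'
      linear_combination (Ψ p' * (t * (1 - t))) * hΨe - Ψ p' * hrz + z * (1 - t ^ 3) * hΨp'
  have hleft : ∀ a, Ψ (Φ a) = a := by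
    intro a
    obtain ⟨f, rfl⟩ := Ideal.Quotient.mk_surjective a
    exact DFunLike.congr_fun hΨΦ f
  have hΦt : Φ t = τ := by
    have h : Φ t * Φ (x - 1) = p * (τ * e) := by
      rw [← map_mul, ht, mul_assoc, mul_comm i, hi, mul_one, map_mul, map_sub, map_one, hq, φy,
        Φ.commutes]
      ring
    rw [map_sub, hq, φx, map_one] at h
    have hpe := (hpu.mul heu).mul_left_injective
    apply hpe
    linear_combination h
  have hright : Φ.comp Ψ = AlgHom.id K L := by
    have : (Φ.comp Ψ : L →+* L) = (AlgHom.id K L : L →+* L) := by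
      refine IsLocalization.ringHom_ext (Submonoid.powers (removedPoly π)) ?_
      refine Polynomial.ringHom_ext (fun a => ?_) ?_
      · have : algebraMap K[X] L (C a) = algebraMap K L a := by
          rw [← Polynomial.algebraMap_eq, ← IsScalarTower.algebraMap_apply]
        simp only [RingHom.comp_apply, this, RingHom.coe_coe, AlgHom.commutes]
      · change Φ (Ψ τ) = τ
        rw [hΨτ, hΦt]
    exact AlgHom.ext fun a => RingHom.congr_fun this a
  exact ⟨{ toFun := Φ, invFun := Ψ, left_inv := hleft,
           right_inv := fun a => DFunLike.congr_fun hright a,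
           map_mul' := map_mul Φ, map_add' := map_add Φ }⟩

theorem curveIdeal_isPrime_and_ringKrullDim {t : K} (hπ : π ≠ 0)
    (ht : (removedPoly π).eval t ≠ 0) :
    (curveIdeal π).IsPrime ∧ ringKrullDim (Laurent K 3 ⧸ curveIdeal π) = 1 := by
  obtain ⟨E⟩ := exists_curveRing_ringEquiv hπ
  obtain ⟨hd, hk⟩ := ringKrullDim_curveRing ht
  refine ⟨?_, (ringKrullDim_eq_of_ringEquiv E).trans hk⟩
  rw [← Ideal.Quotient.isDomain_iff_prime]
  exact E.toMulEquiv.isDomain _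

/-- The point `τ = π` works: apart from `π` itself, every factor is `1` plus an element of positive
valuation. The last two factors coincide there. -/
theorem removedPoly_eval_ne_zero (v : AddValuation K (WithTop ℝ))
    (hπ : v π = ((1 : ℝ) : WithTop ℝ)) : (removedPoly π).eval π ≠ 0 := by
  have hne : π ≠ 0 := by rintro rfl; simp at hπ
  have h3 : 0 < v (π ^ 3) := by
    rw [v.map_pow, hπ, ← WithTop.coe_nsmul, ← WithTop.coe_zero, WithTop.coe_lt_coe]
    norm_num
  have h1 : 0 < v π := by
    rw [hπ, ← WithTop.coe_zero, WithTop.coe_lt_coe]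
    norm_num
  have aux : ∀ a, 0 < v a → 1 - a ≠ 0 := by
    intro a ha h
    rw [sub_eq_zero] at h
    rw [← h, v.map_one] at ha
    exact ha.false
  simp only [removedPoly, eval_mul, eval_sub, eval_add, eval_X, eval_C, eval_pow, eval_one]
  have h4 : 1 + π - π ^ 3 ≠ 0 := by
    have hlt : 0 < v (π ^ 3 - π) := by
      rw [sub_eq_add_neg]
      exact v.map_lt_add h3 (by rwa [v.map_neg])
    convert aux (π ^ 3 - π) hlt using 1
    ring
  exact mul_ne_zero (mul_ne_zero (mul_ne_zero hne (aux _ h3)) h4) h4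

end Integral

/-! ### Reductions of coordinates and constants. -/

section InitialElements

variable {K : Type*} [Field K] {v : AddValuation K (WithTop ℝ)} {N : ℕ} (r : Splitting v)
  {I : Ideal (Laurent K N)} {w : Fin N → ℝ}

theorem phi_mem_initialIdeal (f : tilted v w) (hf : (f : Laurent K N) ∈ I) :
    phi r w f ∈ initialIdeal r I w :=
  Ideal.mem_map_of_mem _ hf

theorem phi_single_of_pos (u : Fin N → ℤ) (a : K) (h : 0 < v a + (dot w u : WithTop ℝ)) :
    phi r w ⟨AddMonoidAlgebra.single u a, single_mem_tilted h.le⟩ = 0 := by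
  change initialForm r w _ = 0
  rw [initialForm_single, redCoeff_of_ne r h.ne', AddMonoidAlgebra.single_zero]

theorem phi_single_one (u : Fin N → ℤ) (h : dot w u = 0) :
    phi r w ⟨AddMonoidAlgebra.single u 1, single_mem_tilted (by simp [h])⟩ =
      AddMonoidAlgebra.single u 1 := by
  change initialForm r w _ = _
  rw [initialForm_single, h, redCoeff_one]

theorem exists_tilted_single_of_pos (u : Fin N → ℤ) (a : K)
    (h : 0 < v a + (dot w u : WithTop ℝ)) :
    ∃ f : tilted v w, (f : Laurent K N) = AddMonoidAlgebra.single u a ∧ phi r w f = 0 :=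
  ⟨_, rfl, phi_single_of_pos r u a h⟩

theorem dot_single (w : Fin N → ℝ) (i : Fin N) (n : ℤ) : dot w (Pi.single i n) = w i * n := by
  classical
  rw [dot, Finset.sum_eq_single i] <;> simp +contextual

theorem exists_tilted_coord (i : Fin N) (h : w i = 0) :
    ∃ f : tilted v w, (f : Laurent K N) = coord K i ∧ phi r w f = coord (ResField v) i :=
  ⟨_, rfl, phi_single_one r (Pi.single i 1) (by rw [dot_single, h, zero_mul])⟩

theorem exists_tilted_coord_of_pos (i : Fin N) (h : 0 < w i) :
    ∃ f : tilted v w, (f : Laurent K N) = coord K i ∧ phi r w f = 0 := by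
  refine exists_tilted_single_of_pos r (Pi.single i 1) 1 ?_
  rw [dot_single, v.map_one, zero_add]
  exact_mod_cast (by simpa using h)

theorem exists_tilted_coord_inv_of_neg (i : Fin N) (h : w i < 0) :
    ∃ f : tilted v w, coord K i * (f : Laurent K N) = 1 ∧ phi r w f = 0 := by
  obtain ⟨f, hf, hf'⟩ := exists_tilted_single_of_pos r (w := w) (Pi.single i (-1)) (1 : K) (by
    rw [dot_single, v.map_one, zero_add]
    exact_mod_cast (by simpa using h))
  refine ⟨f, ?_, hf'⟩
  rw [hf]
  exact (coordUnit K i).val_inv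

end InitialElements

/-! ### Explicit elements of the initial ideals. -/

section CurveInitial

variable {K : Type*} [Field K] {v : AddValuation K (WithTop ℝ)} (r : Splitting v)
  {π : K} {w : Fin 3 → ℝ}

theorem ne_zero_of_val (hπ : v π = ((1 : ℝ) : WithTop ℝ)) : π ≠ 0 := by
  rintro rfl
  simp at hπ

theorem cst_mul_single (u : Fin 3 → ℤ) (a b : K) :
    cst a * AddMonoidAlgebra.single u b = AddMonoidAlgebra.single u (a * b) := by
  change AddMonoidAlgebra.single 0 a * _ = _
  rw [AddMonoidAlgebra.single_mul_single, zero_add]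

theorem exists_tilted_cst (hπ : v π = ((1 : ℝ) : WithTop ℝ)) :
    ∃ f : tilted v w, (f : Laurent K 3) = cst π ∧ phi r w f = 0 := by
  refine exists_tilted_single_of_pos r 0 π ?_
  rw [dot_zero, hπ]
  exact_mod_cast (by norm_num)

theorem exists_tilted_cst_mul_coord (hπ : v π = ((1 : ℝ) : WithTop ℝ)) (h : -1 < w 2) :
    ∃ f : tilted v w, (f : Laurent K 3) = cst π * coord K 2 ∧ phi r w f = 0 := by
  obtain ⟨f, hf, hf'⟩ := exists_tilted_single_of_pos r (w := w) (Pi.single 2 1) π (by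
    rw [dot_single, hπ]
    exact_mod_cast (by simp; linarith))
  refine ⟨f, ?_, hf'⟩
  rw [hf, coord, cst_mul_single, mul_one]

theorem exists_tilted_cst_mul_coord_inv (hπ : v π = ((1 : ℝ) : WithTop ℝ)) (h : w 2 < -1) :
    ∃ f : tilted v w, cst π * coord K 2 * (f : Laurent K 3) = 1 ∧ phi r w f = 0 := by
  obtain ⟨f, hf, hf'⟩ := exists_tilted_single_of_pos r (w := w) (Pi.single 2 (-1)) π⁻¹ (by
    rw [dot_single, v.map_inv, hπ]
    have : (-((1 : ℝ) : WithTop ℝ)) = ((-1 : ℝ) : WithTop ℝ) := rfl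
    rw [this]
    exact_mod_cast (by simp; linarith))
  refine ⟨f, ?_, hf'⟩
  rw [hf, coord, cst_mul_single, AddMonoidAlgebra.single_mul_single, ← Pi.single_add]
  simp [ne_zero_of_val hπ, AddMonoidAlgebra.one_def]

/-- For `Z > -1` both `π` and `πz` reduce to `0`, so the equation for `x` reads `(x - 1)² = 0` to
leading order. If `X > 0` it reduces to `1`; if `X < 0` it does so after multiplication by `x⁻²`. -/
theorem initialIdeal_eq_top_of_coord_zero_ne (hπ : v π = ((1 : ℝ) : WithTop ℝ)) (hZ : -1 < w 2)
    (hX : w 0 ≠ 0) : initialIdeal r (curveIdeal π) w = ⊤ := by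
  rw [Ideal.eq_top_iff_one]
  obtain ⟨p, hp, hp'⟩ := exists_tilted_cst r (w := w) hπ
  obtain ⟨q, hq, hq'⟩ := exists_tilted_cst_mul_coord r hπ hZ
  have hmem := x_equation_mem (ne_zero_of_val hπ)
  rw [← hq, ← hp] at hmem
  rcases lt_or_gt_of_ne hX with hX | hX
  · obtain ⟨x, hx, hx'⟩ := exists_tilted_coord_inv_of_neg (v := v) r 0 hX
    convert phi_mem_initialIdeal r (I := curveIdeal π)
      ((1 - (q + q + q)) * ((1 - x) * (1 - x - p * x)) - p ^ 2 * q ^ 3 * x ^ 2) ?_ using 1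
    · simp [hp', hq', hx']
    · convert Ideal.mul_mem_left _ ((x : Laurent K 3) ^ 2) hmem using 1
      push_cast
      set X := coord K (0 : Fin 3)
      linear_combination (-(1 - 3 * (q : Laurent K 3)) * (X * x + 1 - x - x * (1 + p))) * hx
  · obtain ⟨x, hx, hx'⟩ := exists_tilted_coord_of_pos (v := v) r 0 hX
    rw [← hx] at hmem
    convert phi_mem_initialIdeal r (I := curveIdeal π)
      ((1 - 3 * q) * ((x - 1) * (x - 1 - p)) - p ^ 2 * q ^ 3) hmem using 1
    simp [hp', hq', hx']

theorem initialIdeal_eq_top_of_coord_one_ne (hπ : v π = ((1 : ℝ) : WithTop ℝ)) (hZ : -1 < w 2)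
    (hY : w 1 ≠ 0) : initialIdeal r (curveIdeal π) w = ⊤ := by
  rw [Ideal.eq_top_iff_one]
  obtain ⟨q, hq, hq'⟩ := exists_tilted_cst_mul_coord r hπ hZ
  have hmem := y_equation_mem (ne_zero_of_val hπ)
  rw [← hq] at hmem
  rcases lt_or_gt_of_ne hY with hY | hY
  · obtain ⟨y, hy, hy'⟩ := exists_tilted_coord_inv_of_neg (v := v) r 1 hY
    convert phi_mem_initialIdeal r (I := curveIdeal π)
      ((1 - (q + q + q)) * ((1 - y) ^ 2 - q * y * (1 - y)) - q ^ 3 * y ^ 2) ?_ using 1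
    · simp [hq', hy']
    · convert Ideal.mul_mem_left _ ((y : Laurent K 3) ^ 2) hmem using 1
      push_cast
      set Y := coord K (1 : Fin 3)
      linear_combination (-(1 - 3 * (q : Laurent K 3)) * (Y * y + 1 - 2 * y - q * y)) * hy
  · obtain ⟨y, hy, hy'⟩ := exists_tilted_coord_of_pos (v := v) r 1 hY
    rw [← hy] at hmem
    convert phi_mem_initialIdeal r (I := curveIdeal π)
      ((1 - 3 * q) * ((y - 1) ^ 2 - q * (y - 1)) - q ^ 3) hmem using 1
    simp [hq', hy']

/-- Here `(πz)³` dominates the equation for `y`. This keeps the tropicalization from continuing down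
the axis past the end of the ray, which the topological stratum depends on. -/
theorem initialIdeal_eq_top_of_lt_neg_one (hπ : v π = ((1 : ℝ) : WithTop ℝ)) (hZ : w 2 < -1)
    (hY : w 1 = 0) : initialIdeal r (curveIdeal π) w = ⊤ := by
  rw [Ideal.eq_top_iff_one]
  obtain ⟨q, hq, hq'⟩ := exists_tilted_cst_mul_coord_inv r hπ hZ
  obtain ⟨y, hy, hy'⟩ := exists_tilted_coord (v := v) r 1 hY
  have hmem := y_equation_mem (ne_zero_of_val hπ)
  rw [← hy] at hmem
  convert phi_mem_initialIdeal r (I := curveIdeal π)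
    (1 - q * (q - 1 - 1 - 1) * (q * (y - 1) ^ 2 - (y - 1))) ?_ using 1
  · simp [hq']
  · convert Ideal.mul_mem_left _ (-(q : Laurent K 3) ^ 3) hmem using 1
    push_cast
    set Q := cst π * coord K (2 : Fin 3)
    have h2 : Q ^ 2 * (q : Laurent K 3) ^ 2 = 1 := by rw [← mul_pow, hq, one_pow]
    have h3 : Q ^ 3 * (q : Laurent K 3) ^ 3 = 1 := by rw [← mul_pow, hq, one_pow]
    linear_combination (-1 : Laurent K 3) * h3 + 3 * q * ((y : Laurent K 3) - 1) * h2 -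
      (3 * q ^ 2 * ((y : Laurent K 3) - 1) ^ 2 + q ^ 2 * ((y : Laurent K 3) - 1)) * hq

/-- In the linear relation `z(x - 1)` now dominates `y - 1`; dividing by `z` makes it visible in the
reduction. The square comes from the equation for `y`. -/
theorem span_le_initialIdeal_of_neg (hπ : v π = ((1 : ℝ) : WithTop ℝ)) (hX : w 0 = 0)
    (hY : w 1 = 0) (hZ : -1 < w 2) (hZ' : w 2 < 0) :
    Ideal.span {coord (ResField v) 0 - 1, (coord (ResField v) 1 - 1) ^ 2} ≤
      initialIdeal r (curveIdeal π) w := by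
  obtain ⟨p, hp, hp'⟩ := exists_tilted_cst r (w := w) hπ
  obtain ⟨q, hq, hq'⟩ := exists_tilted_cst_mul_coord r hπ hZ
  obtain ⟨x, hx, hx'⟩ := exists_tilted_coord (v := v) r 0 hX
  obtain ⟨y, hy, hy'⟩ := exists_tilted_coord (v := v) r 1 hY
  obtain ⟨z, hz, hz'⟩ := exists_tilted_coord_inv_of_neg (v := v) r 2 hZ'
  rw [Ideal.span_le, Set.pair_subset_iff]
  constructor
  · convert phi_mem_initialIdeal r (I := curveIdeal π)
      ((x - 1) - z * (y - 1) + (p + p) * (y - 1) - p * q) ?_ using 1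
    · simp [hx', hy', hp', hz', hq']
    · convert Ideal.mul_mem_left _ (-(z : Laurent K 3)) (linear_relation_mem (ne_zero_of_val hπ))
        using 1
      push_cast
      rw [hp, hq, hx, hy]
      linear_combination (-(coord K 0 - 1) - 2 * cst π * (coord K 1 - 1) +
        cst π ^ 2 * coord K 2) * hz
  · convert phi_mem_initialIdeal r (I := curveIdeal π)
      ((1 - 3 * q) * ((y - 1) ^ 2 - q * (y - 1)) - q ^ 3) ?_ using 1
    · simp [hy', hq']
    · have hmem := y_equation_mem (ne_zero_of_val hπ)
      rwa [← hq, ← hy] at hmem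

theorem sq_mem_initialIdeal (hπ : v π = ((1 : ℝ) : WithTop ℝ)) (hX : w 0 = 0)
    (hY : w 1 = 0) (hZ : -1 < w 2) :
    (coord (ResField v) 0 - 1) ^ 2 ∈ initialIdeal r (curveIdeal π) w := by
  obtain ⟨p, hp, hp'⟩ := exists_tilted_cst r (w := w) hπ
  obtain ⟨q, hq, hq'⟩ := exists_tilted_cst_mul_coord r hπ hZ
  obtain ⟨x, hx, hx'⟩ := exists_tilted_coord (v := v) r 0 hX
  obtain ⟨y, hy, hy'⟩ := exists_tilted_coord (v := v) r 1 hY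
  convert phi_mem_initialIdeal r (I := curveIdeal π)
    ((x - 1) * (x - 1 - p) - p ^ 2 * (y - 1) * (y - 1 - q)) ?_ using 1
  · simp [hx', hy', hp', hq', sq]
  · have hmem := x_quadric_mem (π := π)
    rwa [← hq, ← hy, ← hx, ← hp] at hmem

theorem span_le_initialIdeal_of_zero (hπ : v π = ((1 : ℝ) : WithTop ℝ)) (hX : w 0 = 0)
    (hY : w 1 = 0) (hZ : w 2 = 0) :
    Ideal.span {(coord (ResField v) 0 - 1) ^ 2,
      (coord (ResField v) 0 - 1) * coord (ResField v) 2 - (coord (ResField v) 1 - 1)} ≤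
      initialIdeal r (curveIdeal π) w := by
  have hZ' : -1 < w 2 := by rw [hZ]; norm_num
  obtain ⟨q, hq, hq'⟩ := exists_tilted_cst_mul_coord r hπ hZ'
  obtain ⟨x, hx, hx'⟩ := exists_tilted_coord (v := v) r 0 hX
  obtain ⟨y, hy, hy'⟩ := exists_tilted_coord (v := v) r 1 hY
  obtain ⟨z, hz, hz'⟩ := exists_tilted_coord (v := v) r 2 hZ
  rw [Ideal.span_le, Set.pair_subset_iff]
  refine ⟨sq_mem_initialIdeal r hπ hX hY hZ', ?_⟩
  rw [SetLike.mem_coe, ← neg_mem_iff]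
  convert phi_mem_initialIdeal r (I := curveIdeal π)
    ((y - 1) - z * (x - 1) - 2 * q * (y - 1) + q ^ 2) ?_ using 1
  · simp [hx', hy', hz', hq', mul_comm]
  · have hmem := linear_relation_mem (ne_zero_of_val hπ)
    rwa [← hq, ← hy, ← hx, ← hz] at hmem

theorem span_le_initialIdeal_of_pos (hπ : v π = ((1 : ℝ) : WithTop ℝ)) (hX : w 0 = 0)
    (hY : w 1 = 0) (hZ : 0 < w 2) :
    Ideal.span {(coord (ResField v) 0 - 1) ^ 2, coord (ResField v) 1 - 1} ≤
      initialIdeal r (curveIdeal π) w := by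
  have hZ' : -1 < w 2 := by linarith
  obtain ⟨q, hq, hq'⟩ := exists_tilted_cst_mul_coord r hπ hZ'
  obtain ⟨x, hx, hx'⟩ := exists_tilted_coord (v := v) r 0 hX
  obtain ⟨y, hy, hy'⟩ := exists_tilted_coord (v := v) r 1 hY
  obtain ⟨z, hz, hz'⟩ := exists_tilted_coord_of_pos (v := v) r 2 hZ
  rw [Ideal.span_le, Set.pair_subset_iff]
  refine ⟨sq_mem_initialIdeal r hπ hX hY hZ', ?_⟩
  convert phi_mem_initialIdeal r (I := curveIdeal π)
    ((y - 1) - z * (x - 1) - 2 * q * (y - 1) + q ^ 2) ?_ using 1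
  · simp [hx', hy', hz', hq']
  · have hmem := linear_relation_mem (ne_zero_of_val hπ)
    rwa [← hq, ← hy, ← hx, ← hz] at hmem

/-- At `(0, 0, -1)` the initial degeneration does not contain the point `(1, 1, 1)`. -/
theorem not_initialIdeal_le_ker (hπ : v π = ((1 : ℝ) : WithTop ℝ)) {B : Type*} [CommRing B]
    [Nontrivial B] (F : Laurent (ResField v) 3 →+* B) (h1 : F (coord (ResField v) 1) = 1)
    (hY : w 1 = 0) (hZ : w 2 = -1) :
    ¬ initialIdeal r (curveIdeal π) w ≤ RingHom.ker F := by
  intro hle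
  obtain ⟨y, hy, hy'⟩ := exists_tilted_coord (v := v) r 1 hY
  have h0 : 0 ≤ v π + (dot w (Pi.single 2 1) : WithTop ℝ) := by
    rw [dot_single, hπ, hZ, ← WithTop.coe_add]
    norm_num
  have h0' : 0 ≤ v π⁻¹ + (dot w (Pi.single 2 (-1)) : WithTop ℝ) := by
    rw [dot_single, v.map_inv, hπ, hZ]
    have : (-((1 : ℝ) : WithTop ℝ)) = ((-1 : ℝ) : WithTop ℝ) := rfl
    rw [this, ← WithTop.coe_add]
    norm_num
  let q : tilted v w := ⟨_, single_mem_tilted h0⟩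
  let q' : tilted v w := ⟨_, single_mem_tilted h0'⟩
  have hq : (q : Laurent K 3) = cst π * coord K 2 := by
    rw [coord, cst_mul_single, mul_one]
  have hqq : q * q' = 1 := by
    ext1
    change AddMonoidAlgebra.single _ _ * AddMonoidAlgebra.single _ _ = 1
    rw [AddMonoidAlgebra.single_mul_single, ← Pi.single_add]
    simp [ne_zero_of_val hπ, AddMonoidAlgebra.one_def]
  have hmem := y_equation_mem (ne_zero_of_val hπ)
  rw [← hy, ← hq] at hmem
  have h := hle (phi_mem_initialIdeal r (I := curveIdeal π)
    ((1 - 3 * q) * ((y - 1) ^ 2 - q * (y - 1)) - q ^ 3) hmem)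
  rw [RingHom.mem_ker] at h
  simp only [map_sub, map_mul, map_pow, map_one, hy', h1, sub_self] at h
  have hu : IsUnit (F (phi r w q)) := ((IsUnit.of_mul_eq_one _ hqq).map (phi r w)).map F
  -- At `Z = -1` the element `πz` reduces to a unit, whereas the equation for `y` at `y = 1` forces
  -- its cube to vanish.
  have hz : F (phi r w q) ^ 3 = 0 := by linear_combination -h
  exact (hu.pow 3).ne_zero hz

end CurveInitial

/-! ### First-order Taylor expansion along the subtorus `x = y = 1`. -/

section FirstOrder

/-- Since `u⁻¹ = 2 - u`, negative exponents also follow the first-order binomial formula. Laurent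
monomials thereby become affine in their exponents modulo second order. -/
theorem Units.val_zpow_of_sub_one_sq {B : Type*} [CommRing B] (u : Bˣ)
    (h : ((u : B) - 1) ^ 2 = 0) (n : ℤ) : ((u ^ n : Bˣ) : B) = 1 + n * ((u : B) - 1) := by
  have hinv : ((u⁻¹ : Bˣ) : B) = 2 - u := by
    rw [← Units.mul_right_inj u, Units.mul_inv]
    linear_combination h
  induction n using Int.induction_on with
  | zero => simp
  | succ n ih =>
    rw [zpow_add_one, Units.val_mul, ih]
    push_cast
    linear_combination (n : B) * h
  | pred n ih =>
    rw [zpow_sub_one, Units.val_mul, ih, hinv]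
    push_cast
    linear_combination (n : B) * h

variable {A : Type*} [CommRing A]

/-- The operator `∑ a_u x^u ↦ ∑ c(u) a_u z^{u_z}` on Laurent polynomials in `x`, `y`, `z`. -/
def zProj (c : (Fin 3 → ℤ) → ℤ) : Laurent A 3 →+ Laurent A 3 :=
  (Finsupp.liftAddHom fun u : Fin 3 → ℤ =>
    (AddMonoidAlgebra.singleAddHom (Pi.single 2 (u 2))).comp
      (zsmulAddGroupHom (c u) : A →+ A)).comp
    (AddMonoidAlgebra.coeffAddEquiv (R := A) (M := Fin 3 → ℤ)).toAddMonoidHom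

theorem zProj_single (c : (Fin 3 → ℤ) → ℤ) (u : Fin 3 → ℤ) (a : A) :
    zProj c (AddMonoidAlgebra.single u a) =
      AddMonoidAlgebra.single (Pi.single 2 (u 2)) (c u * a) := by
  simp [zProj]

/-- The coefficient of `z^n` in `zProj c f`. -/
def zSum (c : (Fin 3 → ℤ) → ℤ) (f : Laurent A 3) (n : ℤ) : A :=
  ∑ u ∈ f.coeff.support, if u 2 = n then c u * f.coeff u else 0

theorem zProj_coeff (c : (Fin 3 → ℤ) → ℤ) (f : Laurent A 3) (u : Fin 3 → ℤ) :
    (zProj c f).coeff u = if u = Pi.single 2 (u 2) then zSum c f (u 2) else 0 := by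
  have h : zProj c f = ∑ u ∈ f.coeff.support,
      AddMonoidAlgebra.single (Pi.single 2 (u 2)) (c u * f.coeff u) := by
    simp [zProj, Finsupp.sum]
  rw [h, AddMonoidAlgebra.coeff_sum, Finset.sum_apply']
  simp only [AddMonoidAlgebra.coeff_single, Finsupp.single_apply]
  split_ifs with hu
  · refine Finset.sum_congr rfl fun u' _ => ?_
    congr 1
    rw [eq_iff_iff]
    constructor
    · intro h
      simpa using congrFun h 2
    · intro h
      rw [h, ← hu]
  · refine Finset.sum_eq_zero fun u' _ => if_neg fun h => hu ?_
    rw [← h]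
    simp

/-- Taylor's formula: with weights `1`, `u 0`, `u 1` the operator `zProj` gives the value at `x = y
= 1` and the two partial derivatives there. Second-order terms lie in `J`. -/
theorem sub_zProj_mem {J : Ideal (Laurent A 3)} (hxx : (coord A 0 - 1) ^ 2 ∈ J)
    (hxy : (coord A 0 - 1) * (coord A 1 - 1) ∈ J) (hyy : (coord A 1 - 1) ^ 2 ∈ J)
    (g : Laurent A 3) :
    g - (zProj (fun _ => 1) g + (coord A 0 - 1) * zProj (fun u => u 0) g +
      (coord A 1 - 1) * zProj (fun u => u 1) g) ∈ J := by
  induction g using AddMonoidAlgebra.induction_linear with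
  | zero => simp
  | add f g hf hg =>
    convert add_mem hf hg using 1
    simp only [map_add]
    ring
  | single u a =>
    have hs : (AddMonoidAlgebra.single u a : Laurent A 3) = AddMonoidAlgebra.single 0 a *
        ((coordUnit A 0 ^ u 0 * coordUnit A 1 ^ u 1 * coordUnit A 2 ^ u 2 : (Laurent A 3)ˣ) :
          Laurent A 3) := by
      rw [← Fin.prod_univ_three (fun i => coordUnit A i ^ u i), prod_coordUnit_zpow,
        AddMonoidAlgebra.single_mul_single, zero_add, mul_one]
    have hz : ∀ c : ℤ, (AddMonoidAlgebra.single (Pi.single 2 (u 2)) ((c : A) * a) : Laurent A 3) =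
        AddMonoidAlgebra.single 0 a * ((c : Laurent A 3) * ((coordUnit A 2 ^ u 2 : (Laurent A 3)ˣ) :
          Laurent A 3)) := by
      intro c
      have hc : (c : Laurent A 3) = AddMonoidAlgebra.single 0 (c : A) := by
        simp [AddMonoidAlgebra.intCast_def]
      rw [coordUnit_zpow, hc, AddMonoidAlgebra.single_mul_single,
        AddMonoidAlgebra.single_mul_single, zero_add, zero_add, mul_one, mul_comm]
    simp only [zProj_single, hz]
    rw [hs]
    rw [← Ideal.Quotient.eq_zero_iff_mem] at hxx hxy hyy ⊢
    have key : ∀ i : Fin 3, (Ideal.Quotient.mk J (coord A i - 1)) ^ 2 = 0 → ∀ n : ℤ,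
        Ideal.Quotient.mk J ((coordUnit A i ^ n : (Laurent A 3)ˣ) : Laurent A 3) =
          1 + n * Ideal.Quotient.mk J (coord A i - 1) := by
      intro i hi n
      have h := Units.val_zpow_of_sub_one_sq
        (Units.map (Ideal.Quotient.mk J : Laurent A 3 →* Laurent A 3 ⧸ J) (coordUnit A i))
        (by simpa [coordUnit_val] using hi) n
      rw [← map_zpow] at h
      simpa only [Units.coe_map, MonoidHom.coe_coe, coordUnit_val, map_sub, map_one] using h
    rw [map_pow] at hxx hyy
    rw [map_mul] at hxy
    simp only [map_sub, map_add, map_mul, Units.val_mul, key 0 hxx, key 1 hyy, map_one,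
      map_intCast, Int.cast_one] at hxy ⊢
    linear_combination (Ideal.Quotient.mk J (AddMonoidAlgebra.single 0 a) * u 0 * u 1 *
      Ideal.Quotient.mk J ((coordUnit A 2 ^ u 2 : (Laurent A 3)ˣ) : Laurent A 3)) * hxy

end FirstOrder

/-! ### Restriction and derivatives along the subtorus commute with initial forms. -/

section InitialProj

variable {K : Type*} [Field K] {v : AddValuation K (WithTop ℝ)} (r : Splitting v)
  {w : Fin 3 → ℝ}

theorem nonneg_val_intCast (c : ℤ) : 0 ≤ v (c : K) :=
  (mem_valRing v).mp (intCast_mem (valRing v) c)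

theorem redCoeff_intCast_mul (c : ℤ) {γ : ℝ} {a : K} (h : 0 ≤ v a + (γ : WithTop ℝ)) :
    redCoeff r γ (c * a) = c * redCoeff r γ a := by
  by_cases hγ : γ ∈ valueGroup v
  · have h' : 0 ≤ v (c * a) + (γ : WithTop ℝ) := by
      rw [v.map_mul, add_assoc]
      exact add_nonneg (nonneg_val_intCast c) h
    rw [redCoeff_of_mem r hγ h, redCoeff_of_mem r hγ h',
      ← map_intCast (IsLocalRing.residue (valRing v)), ← map_mul]
    congr 1
    ext
    simp [mul_assoc]
  · rw [redCoeff_of_notMem r hγ, redCoeff_of_notMem r hγ, mul_zero]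

theorem dot_eq (hX : w 0 = 0) (hY : w 1 = 0) (u : Fin 3 → ℤ) : dot w u = w 2 * u 2 := by
  simp [dot, Fin.sum_univ_three, hX, hY]

/-- On the axis the weight of a monomial depends only on its `z`-exponent, which `zProj` preserves,
and integer factors have nonnegative valuation. -/
theorem initialForm_zProj (hX : w 0 = 0) (hY : w 1 = 0) (c : (Fin 3 → ℤ) → ℤ)
    {f : Laurent K 3} (hf : f ∈ tilted v w) :
    zProj c f ∈ tilted v w ∧ initialForm r w (zProj c f) = zProj c (initialForm r w f) := by
  refine tilted_induction (P := fun f => zProj c f ∈ tilted v w ∧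
    initialForm r w (zProj c f) = zProj c (initialForm r w f)) ?_ ?_ ?_ hf
  · simp [initialForm_zero]
  · intro u a h
    have hd : dot w (Pi.single 2 (u 2)) = dot w u := by
      rw [dot_eq hX hY, dot_eq hX hY, Pi.single_eq_same]
    rw [zProj_single, initialForm_single, initialForm_single, zProj_single, hd,
      redCoeff_intCast_mul r _ h]
    refine ⟨single_mem_tilted ?_, rfl⟩
    rw [hd, v.map_mul, add_assoc]
    exact add_nonneg (nonneg_val_intCast _) h
  · rintro f g _ _ ⟨hf, hf'⟩ ⟨hg, hg'⟩
    rw [map_add]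
    exact ⟨add_mem hf hg, by rw [initialForm_add r w hf hg, hf', hg', ← map_add,
      ← initialForm_add r w ‹_› ‹_›]⟩

theorem initialForm_eq_zero {f : Laurent K 3}
    (h : ∀ u, 0 < v (f.coeff u) + (dot w u : WithTop ℝ)) : initialForm r w f = 0 := by
  ext u
  rw [initialForm_coeff, redCoeff_of_ne r (h u).ne']
  rfl

theorem zProj_initialForm_eq_zero (hX : w 0 = 0) (hY : w 1 = 0) (c : (Fin 3 → ℤ) → ℤ)
    {f : Laurent K 3} (hf : f ∈ tilted v w)
    (h : ∀ n : ℤ, 0 < v (zSum c f n) + ((w 2 * n : ℝ) : WithTop ℝ)) :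
    zProj c (initialForm r w f) = 0 := by
  rw [← (initialForm_zProj r hX hY c hf).2]
  refine initialForm_eq_zero r fun u => ?_
  rw [zProj_coeff, dot_eq hX hY]
  split_ifs
  · exact h _
  · simp

/-- Applied to the two partial derivatives, this says that the derivative of the initial form in the
direction `(1, z)` vanishes. Multiplication by `z` produces the shift to `n - 1`. -/
theorem zProj_add_coord_mul_zProj_initialForm_eq_zero (hX : w 0 = 0) (hY : w 1 = 0)
    (hZ : w 2 = 0) (c c' : (Fin 3 → ℤ) → ℤ) {f : Laurent K 3} (hf : f ∈ tilted v w)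
    (h : ∀ n : ℤ, 0 < v (zSum c f n + zSum c' f (n - 1))) :
    zProj c (initialForm r w f) + coord (ResField v) 2 * zProj c' (initialForm r w f) = 0 := by
  obtain ⟨h1, h1'⟩ := initialForm_zProj r hX hY c hf
  obtain ⟨h2, h2'⟩ := initialForm_zProj r hX hY c' hf
  have hz : coord K 2 ∈ tilted v w := single_mem_tilted (by simp [dot_single, hZ])
  have hz' : initialForm r w (coord K 2) = coord (ResField v) 2 := by
    rw [coord, initialForm_single, dot_single, hZ, zero_mul, redCoeff_one]
    rfl
  rw [← h1', ← h2', ← hz', ← initialForm_mul r w hz h2, ← initialForm_add r w h1 (mul_mem hz h2)]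
  refine initialForm_eq_zero r fun u => ?_
  have hc : (coord K 2 * zProj c' f).coeff u =
      (zProj c' f).coeff (u - (Pi.single 2 1 : Fin 3 → ℤ)) := by
    rw [coord, AddMonoidAlgebra.coeff_single_mul_apply, one_mul, neg_add_eq_sub]
  rw [AddMonoidAlgebra.coeff_add, Finsupp.add_apply, hc, zProj_coeff, zProj_coeff, dot_eq hX hY,
    hZ, zero_mul, WithTop.coe_zero, add_zero]
  have hiff : u - (Pi.single 2 1 : Fin 3 → ℤ) = Pi.single 2 ((u - (Pi.single 2 1 : Fin 3 → ℤ)) 2) ↔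
      u = Pi.single 2 (u 2) := by
    rw [Pi.sub_apply, Pi.single_eq_same, Pi.single_sub, sub_left_inj]
  simp only [hiff]
  split_ifs
  · simpa using h (u 2)
  · simp

variable {π : K}

theorem initialForm_mem_of_neg (hX : w 0 = 0) (hY : w 1 = 0) {f : Laurent K 3}
    (hf : f ∈ tilted v w)
    (h1 : ∀ n : ℤ, 0 < v (zSum (fun _ => 1) f n) + ((w 2 * n : ℝ) : WithTop ℝ))
    (h2 : ∀ n : ℤ, 0 < v (zSum (fun u => u 1) f n) + ((w 2 * n : ℝ) : WithTop ℝ)) :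
    initialForm r w f ∈
      Ideal.span {coord (ResField v) 0 - 1, (coord (ResField v) 1 - 1) ^ 2} := by
  set J : Ideal (Laurent (ResField v) 3) :=
    Ideal.span {coord (ResField v) 0 - 1, (coord (ResField v) 1 - 1) ^ 2}
  have hx : coord (ResField v) 0 - 1 ∈ J := Ideal.subset_span (by simp)
  have hy : (coord (ResField v) 1 - 1) ^ 2 ∈ J := Ideal.subset_span (by simp)
  have h := sub_zProj_mem (Ideal.pow_mem_of_mem J hx 2 two_pos) (Ideal.mul_mem_right _ J hx) hy
    (initialForm r w f)
  rw [zProj_initialForm_eq_zero r hX hY _ hf h1, zProj_initialForm_eq_zero r hX hY _ hf h2,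
    zero_add, mul_zero, add_zero] at h
  simpa using add_mem h (Ideal.mul_mem_right (zProj (fun u => u 0) (initialForm r w f)) J hx)

theorem initialForm_mem_of_pos (hX : w 0 = 0) (hY : w 1 = 0) {f : Laurent K 3}
    (hf : f ∈ tilted v w)
    (h1 : ∀ n : ℤ, 0 < v (zSum (fun _ => 1) f n) + ((w 2 * n : ℝ) : WithTop ℝ))
    (h2 : ∀ n : ℤ, 0 < v (zSum (fun u => u 0) f n) + ((w 2 * n : ℝ) : WithTop ℝ)) :
    initialForm r w f ∈
      Ideal.span {(coord (ResField v) 0 - 1) ^ 2, coord (ResField v) 1 - 1} := by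
  set J : Ideal (Laurent (ResField v) 3) := Ideal.span {(coord (ResField v) 0 - 1) ^ 2, coord (ResField v) 1 - 1}
  have hx : (coord (ResField v) 0 - 1) ^ 2 ∈ J := Ideal.subset_span (by simp)
  have hy : coord (ResField v) 1 - 1 ∈ J := Ideal.subset_span (by simp)
  have h := sub_zProj_mem hx (Ideal.mul_mem_left J _ hy) (Ideal.pow_mem_of_mem J hy 2 two_pos)
    (initialForm r w f)
  rw [zProj_initialForm_eq_zero r hX hY _ hf h1, zProj_initialForm_eq_zero r hX hY _ hf h2,
    zero_add, mul_zero, zero_add] at h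
  simpa using add_mem h (Ideal.mul_mem_right (zProj (fun u => u 1) (initialForm r w f)) J hy)

theorem initialForm_mem_of_zero (hX : w 0 = 0) (hY : w 1 = 0) (hZ : w 2 = 0) {f : Laurent K 3}
    (hf : f ∈ tilted v w)
    (h1 : ∀ n : ℤ, 0 < v (zSum (fun _ => 1) f n) + ((w 2 * n : ℝ) : WithTop ℝ))
    (h2 : ∀ n : ℤ, 0 < v (zSum (fun u => u 0) f n + zSum (fun u => u 1) f (n - 1))) :
    initialForm r w f ∈
      Ideal.span {(coord (ResField v) 0 - 1) ^ 2,
        (coord (ResField v) 0 - 1) * coord (ResField v) 2 - (coord (ResField v) 1 - 1)} := by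
  set J : Ideal (Laurent (ResField v) 3) := Ideal.span {(coord (ResField v) 0 - 1) ^ 2,
        (coord (ResField v) 0 - 1) * coord (ResField v) 2 - (coord (ResField v) 1 - 1)}
  have hx : (coord (ResField v) 0 - 1) ^ 2 ∈ J := Ideal.subset_span (by simp)
  have hy : (coord (ResField v) 0 - 1) * coord (ResField v) 2 - (coord (ResField v) 1 - 1) ∈ J :=
    Ideal.subset_span (by simp)
  have hxy : (coord (ResField v) 0 - 1) * (coord (ResField v) 1 - 1) ∈ J := by
    convert sub_mem (Ideal.mul_mem_left J (coord (ResField v) 2) hx)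
      (Ideal.mul_mem_left J (coord (ResField v) 0 - 1) hy) using 1
    ring
  have hyy : (coord (ResField v) 1 - 1) ^ 2 ∈ J := by
    convert sub_mem (Ideal.mul_mem_left J (coord (ResField v) 2) hxy)
      (Ideal.mul_mem_left J (coord (ResField v) 1 - 1) hy) using 1
    ring
  have h := sub_zProj_mem hx hxy hyy (initialForm r w f)
  rw [zProj_initialForm_eq_zero r hX hY _ hf h1] at h
  have h3 := zProj_add_coord_mul_zProj_initialForm_eq_zero r hX hY hZ (fun u => u 0)
    (fun u => u 1) hf h2
  -- Modulo `J` one has `y - 1 = (x - 1)z`, so the linear Taylor term becomes `(x - 1)` times the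
  -- derivative in the direction `(1, z)`.
  convert sub_mem h (Ideal.mul_mem_left J (zProj (fun u => u 1) (initialForm r w f)) hy) using 1
  linear_combination (coord (ResField v) 0 - 1) * h3

end InitialProj

/-! ### The two branches over Laurent series in the parameter `τ`. -/

section Branches

open PowerSeries

variable {K : Type*} [Field K] {v : AddValuation K (WithTop ℝ)}

variable (v) in
/-- Power series over the valuation ring as Laurent series over the field. -/
def toLaurentSeries : PowerSeries (valRing v) →+* LaurentSeries K :=
  (HahnSeries.ofPowerSeries ℤ K).comp (PowerSeries.map (valRing v).subtype)

theorem toLaurentSeries_coeff_natCast (s : PowerSeries (valRing v)) (n : ℕ) :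
    (toLaurentSeries v s).coeff (n : ℤ) = ((coeff n s : valRing v) : K) := by
  change ((PowerSeries.map (valRing v).subtype s : PowerSeries K) : LaurentSeries K).coeff n = _
  rw [PowerSeries.coeff_coe, if_neg (by omega), Int.natAbs_natCast, PowerSeries.coeff_map]
  rfl

theorem toLaurentSeries_coeff_of_neg (s : PowerSeries (valRing v)) {n : ℤ} (hn : n < 0) :
    (toLaurentSeries v s).coeff n = 0 := by
  change ((PowerSeries.map (valRing v).subtype s : PowerSeries K) : LaurentSeries K).coeff n = _
  rw [PowerSeries.coeff_coe, if_pos hn]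

theorem laurentSeries_algebraMap (a : K) : algebraMap K (LaurentSeries K) a = HahnSeries.C a := by
  rw [HahnSeries.algebraMap_apply', PowerSeries.algebraMap_apply, HahnSeries.ofPowerSeries_C]
  rfl

theorem toLaurentSeries_C (a : valRing v) :
    toLaurentSeries v (C a) = algebraMap K (LaurentSeries K) a := by
  rw [toLaurentSeries, RingHom.comp_apply, PowerSeries.map_C, HahnSeries.ofPowerSeries_C,
    laurentSeries_algebraMap]
  rfl

theorem toLaurentSeries_X :
    toLaurentSeries v X = HahnSeries.single 1 1 := by
  rw [toLaurentSeries, RingHom.comp_apply, PowerSeries.map_X, HahnSeries.ofPowerSeries_X]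

/-- The Laurent series `τ / a` as a unit. -/
def linearUnit {a : K} (ha : a ≠ 0) : (LaurentSeries K)ˣ where
  val := HahnSeries.single 1 a⁻¹
  inv := HahnSeries.single (-1) a
  val_inv := by rw [HahnSeries.single_mul_single, inv_mul_cancel₀ ha]; rfl
  inv_val := by rw [HahnSeries.single_mul_single, mul_inv_cancel₀ ha]; rfl

theorem linearUnit_zpow {a : K} (ha : a ≠ 0) (n : ℤ) :
    ((linearUnit ha ^ n : (LaurentSeries K)ˣ) : LaurentSeries K) =
      HahnSeries.single n (a ^ (-n)) := by
  induction n using Int.induction_on with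
  | zero => simp
  | succ n ih =>
    rw [zpow_add_one, Units.val_mul, ih]
    change _ * HahnSeries.single 1 a⁻¹ = _
    rw [HahnSeries.single_mul_single, neg_add, zpow_add₀ ha, zpow_neg_one]
  | pred n ih =>
    rw [zpow_sub_one, Units.val_mul, ih]
    change _ * HahnSeries.single (-1) a = _
    rw [HahnSeries.single_mul_single, neg_sub', zpow_sub₀ ha, zpow_neg_one, div_inv_eq_mul,
      sub_eq_add_neg]

/-- The point with coordinates `X`, `Y` and `(τ / a) Q` over the field of Laurent series. -/
def branchPoint {a : K} (ha : a ≠ 0) (X Y Q : (PowerSeries (valRing v))ˣ) :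
    Fin 3 → (LaurentSeries K)ˣ :=
  ![Units.map (toLaurentSeries v) X, Units.map (toLaurentSeries v) Y,
    linearUnit ha * Units.map (toLaurentSeries v) Q]

theorem laurentEval_eq_sum {A : Type*} [CommRing A] {N : ℕ} {B : Type*} [CommRing B]
    [Algebra A B] (t : Fin N → Bˣ) (f : Laurent A N) :
    laurentEval t f = ∑ u ∈ f.coeff.support, f.coeff u • ((∏ i, t i ^ u i : Bˣ) : B) := by
  rw [laurentEval, AddMonoidAlgebra.lift_apply]
  rfl

theorem laurentEval_branchPoint_coeff {a : K} (ha : a ≠ 0) (X Y Q : (PowerSeries (valRing v))ˣ)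
    (f : Laurent K 3) (n : ℤ) :
    (laurentEval (branchPoint ha X Y Q) f).coeff n = ∑ u ∈ f.coeff.support,
      f.coeff u * (a ^ (-u 2) * (toLaurentSeries v
        ((X ^ u 0 * Y ^ u 1 * Q ^ u 2 : (PowerSeries (valRing v))ˣ) :
          PowerSeries (valRing v))).coeff (n - u 2)) := by
  rw [laurentEval_eq_sum, HahnSeries.coeff_sum]
  refine Finset.sum_congr rfl fun u _ => ?_
  have h : ((∏ i, branchPoint ha X Y Q i ^ u i : (LaurentSeries K)ˣ) : LaurentSeries K) =
      HahnSeries.single (u 2) (a ^ (-u 2)) * toLaurentSeries v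
        ((X ^ u 0 * Y ^ u 1 * Q ^ u 2 : (PowerSeries (valRing v))ˣ) :
          PowerSeries (valRing v)) := by
    rw [← linearUnit_zpow ha, Fin.prod_univ_three]
    simp only [branchPoint, Matrix.cons_val, mul_zpow, ← map_zpow, Units.val_mul, Units.coe_map,
      map_mul, MonoidHom.coe_coe]
    ring
  rw [h, Algebra.smul_def, laurentSeries_algebraMap, HahnSeries.C_apply,
    HahnSeries.coeff_single_zero_mul, HahnSeries.coeff_single_mul]

/-- The square of the ideal generated by `p` and the variable. -/
def firstOrderIdeal (p : valRing v) : Ideal (PowerSeries (valRing v)) :=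
  Ideal.span {C p ^ 2, C p * X, X ^ 2}

theorem mem_firstOrderIdeal {p : valRing v} {s : PowerSeries (valRing v)} :
    s ∈ firstOrderIdeal p ↔
      ∃ s₁ s₂ s₃, s = s₁ * C p ^ 2 + (s₂ * (C p * X) + s₃ * X ^ 2) := by
  rw [firstOrderIdeal, Ideal.mem_span_insert]
  constructor
  · rintro ⟨s₁, t, ht, rfl⟩
    obtain ⟨s₂, s₃, rfl⟩ := Ideal.mem_span_pair.mp ht
    exact ⟨s₁, s₂, s₃, rfl⟩
  · rintro ⟨s₁, s₂, s₃, rfl⟩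
    exact ⟨s₁, _, Ideal.mem_span_pair.mpr ⟨s₂, s₃, rfl⟩, rfl⟩

/-- The two branches of the curve near the torus `x = y = 1`, as points over Laurent series. -/
theorem exists_branches {p : valRing v} (hp : v (p : K) = ((1 : ℝ) : WithTop ℝ))
    (hp0 : (p : K) ≠ 0) :
    ∃ X₁ Y₁ X₂ Y₂ Q : (PowerSeries (valRing v))ˣ,
      (∀ f ∈ curveIdeal (p : K), laurentEval (branchPoint hp0 X₁ Y₁ Q) f = 0) ∧
      (∀ f ∈ curveIdeal (p : K), laurentEval (branchPoint hp0 X₂ Y₂ Q) f = 0) ∧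
      (X₁ : PowerSeries (valRing v)) - (1 + C p) ∈ firstOrderIdeal p ∧
      (Y₁ : PowerSeries (valRing v)) - (1 + X) ∈ firstOrderIdeal p ∧
      (X₂ : PowerSeries (valRing v)) - 1 ∈ firstOrderIdeal p ∧
      (Y₂ : PowerSeries (valRing v)) - 1 ∈ firstOrderIdeal p ∧
      (Q : PowerSeries (valRing v)) - (1 - X) ∈ firstOrderIdeal p := by
  -- The constant term of `x` on the first branch is `1 + p`, a unit because `p` lies in the maximal
  -- ideal.
  have hpu : IsUnit (1 + p) := by
    have : p ∈ nonunits (valRing v) := by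
      intro hu
      obtain ⟨b, hb⟩ := hu.exists_right_inv
      have hb' : (p : K) * (b : K) = 1 := congrArg Subtype.val hb
      have h1 := congrArg v hb'
      rw [v.map_mul, v.map_one, hp] at h1
      have h2 : 0 ≤ v (b : K) := b.2
      have h3 : (0 : WithTop ℝ) < ((1 : ℝ) : WithTop ℝ) := by
        rw [← WithTop.coe_zero, WithTop.coe_lt_coe]
        norm_num
      exact absurd h1 (add_pos_of_pos_of_nonneg h3 h2).ne'
    by_contra h
    have h' := IsLocalRing.nonunits_add (a := 1 + p) (b := -p) h (by simpa using this)
    rw [add_neg_cancel_right] at h'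
    exact h' isUnit_one
  have hu : ∀ s : PowerSeries (valRing v), IsUnit (constantCoeff s) → IsUnit s := fun s hs =>
    PowerSeries.isUnit_iff_constantCoeff.mpr hs
  obtain ⟨e, he⟩ := (hu (1 - X ^ 3) (by simp)).exists_left_inv
  have he0 : constantCoeff e = 1 := by
    simpa using congrArg constantCoeff he
  have he3 : e = 1 + e * X ^ 3 := by linear_combination he
  have hX₁ : IsUnit (1 + C p * e) := hu _ (by simpa [he0] using hpu)
  have hY₁ : IsUnit (1 + X * e) := hu _ (by simp)
  have hX₂ : IsUnit (1 - C p * X ^ 3 * e) := hu _ (by simp)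
  have hY₂ : IsUnit (1 - X ^ 2 * e) := hu _ (by simp)
  have hQ : IsUnit ((1 - X) * e) := hu _ (by simp [he0])
  have hmem : ∀ {s t : PowerSeries (valRing v)}, s = t * X ^ 2 → s ∈ firstOrderIdeal p := by
    rintro _ t rfl
    exact mem_firstOrderIdeal.mpr ⟨0, 0, t, by ring⟩
  have heL : toLaurentSeries v e * (1 - toLaurentSeries v X ^ 3) = 1 := by
    rw [← map_pow, ← map_one (toLaurentSeries v), ← map_sub, ← map_mul, he]
  have hz : algebraMap K (LaurentSeries K) p *
      ((linearUnit hp0 : (LaurentSeries K)ˣ) * toLaurentSeries v ((1 - X) * e)) =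
      toLaurentSeries v X * (1 - toLaurentSeries v X) * toLaurentSeries v e := by
    have : algebraMap K (LaurentSeries K) p * (linearUnit hp0 : (LaurentSeries K)ˣ) =
        toLaurentSeries v X := by
      rw [toLaurentSeries_X, laurentSeries_algebraMap]
      change (HahnSeries.single (0 : ℤ) (p : K) * HahnSeries.single 1 (p : K)⁻¹ :
        LaurentSeries K) = _
      rw [HahnSeries.single_mul_single, zero_add]
      simp [hp0]
    rw [← mul_assoc, this, map_mul, map_sub, map_one, mul_assoc]
  refine ⟨hX₁.unit, hY₁.unit, hX₂.unit, hY₂.unit, hQ.unit, ?_, ?_, ?_, ?_, ?_, ?_, ?_⟩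
  · intro f hf
    refine curveIdeal_le_ker_of_parameter (F := (laurentEval (A := K) (branchPoint hp0 hX₁.unit hY₁.unit
      hQ.unit) : Laurent K 3 →+* LaurentSeries K)) (p := algebraMap K (LaurentSeries K) p)
      (τ := toLaurentSeries v X) (e := toLaurentSeries v e) heL ?_ ?_ ?_ ?_ hf
    · refine (laurentEval_coord _ _).trans ?_
      change toLaurentSeries v (1 + C p * e) = _
      rw [map_add, map_one, map_mul, toLaurentSeries_C]
    · refine (laurentEval_coord _ _).trans ?_
      change toLaurentSeries v (1 + X * e) = _
      rw [map_add, map_one, map_mul]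
    · refine (congrArg _ (laurentEval_coord _ _)).trans hz
    · exact (laurentEval (A := K) (branchPoint hp0 hX₁.unit hY₁.unit hQ.unit)).commutes (p : K)
  · intro f hf
    refine curveIdeal_le_ker_of_inv_parameter (F := (laurentEval (A := K) (branchPoint hp0 hX₂.unit
      hY₂.unit hQ.unit) : Laurent K 3 →+* LaurentSeries K))
      (p := algebraMap K (LaurentSeries K) p)
      (τ := toLaurentSeries v X) (e := toLaurentSeries v e) heL ?_ ?_ ?_ ?_ hf
    · refine (laurentEval_coord _ _).trans ?_
      change toLaurentSeries v (1 - C p * X ^ 3 * e) = _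
      rw [map_sub, map_one, map_mul, map_mul, map_pow, toLaurentSeries_C]
    · refine (laurentEval_coord _ _).trans ?_
      change toLaurentSeries v (1 - X ^ 2 * e) = _
      rw [map_sub, map_one, map_mul, map_pow]
    · refine (congrArg _ (laurentEval_coord _ _)).trans hz
    · exact (laurentEval (A := K) (branchPoint hp0 hX₂.unit hY₂.unit hQ.unit)).commutes (p : K)
  · refine hmem (t := C p * e * X) ?_
    rw [IsUnit.unit_spec]
    linear_combination C p * he3
  · refine hmem (t := e * X ^ 2) ?_
    rw [IsUnit.unit_spec]
    linear_combination X * he3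
  · refine hmem (t := -C p * X * e) ?_
    rw [IsUnit.unit_spec]
    ring
  · refine hmem (t := -e) ?_
    rw [IsUnit.unit_spec]
    ring
  · refine hmem (t := (1 - X) * e * X) ?_
    rw [IsUnit.unit_spec]
    linear_combination (1 - X) * he3

/-- Modulo `firstOrderIdeal p` all products of two of the small quantities `ξ`, `η`, `X` vanish, so
the logarithmic contributions of the three factors simply add. It serves with `(ξ, η) = (p, X)` on
the first branch and `(0, 0)` on the second. -/
theorem monomial_sub_mem {p : valRing v} {X₁ Y₁ Q : (PowerSeries (valRing v))ˣ}
    {ξ η : PowerSeries (valRing v)} (hξη : ξ * η ∈ firstOrderIdeal p)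
    (hξX : ξ * X ∈ firstOrderIdeal p) (hηX : η * X ∈ firstOrderIdeal p)
    (hξ : ξ ^ 2 ∈ firstOrderIdeal p) (hη : η ^ 2 ∈ firstOrderIdeal p)
    (hX : (X₁ : PowerSeries (valRing v)) - (1 + ξ) ∈ firstOrderIdeal p)
    (hY : (Y₁ : PowerSeries (valRing v)) - (1 + η) ∈ firstOrderIdeal p)
    (hQ : (Q : PowerSeries (valRing v)) - (1 - X) ∈ firstOrderIdeal p) (a b c : ℤ) :
    ((X₁ ^ a * Y₁ ^ b * Q ^ c : (PowerSeries (valRing v))ˣ) : PowerSeries (valRing v)) -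
      (1 + (a : PowerSeries (valRing v)) * ξ + (b : PowerSeries (valRing v)) * η -
        (c : PowerSeries (valRing v)) * X) ∈ firstOrderIdeal p := by
  set J := firstOrderIdeal p
  have hXX : (X : PowerSeries (valRing v)) ^ 2 ∈ J :=
    mem_firstOrderIdeal.mpr ⟨0, 0, 1, by ring⟩
  rw [← Ideal.Quotient.eq_zero_iff_mem] at *
  have key : ∀ (u : (PowerSeries (valRing v))ˣ) (ε : PowerSeries (valRing v)),
      Ideal.Quotient.mk J (u - (1 + ε)) = 0 → Ideal.Quotient.mk J (ε ^ 2) = 0 → ∀ n : ℤ,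
      Ideal.Quotient.mk J ((u ^ n : (PowerSeries (valRing v))ˣ) : PowerSeries (valRing v)) =
        1 + n * Ideal.Quotient.mk J ε := by
    intro u ε hu hε n
    rw [map_sub, sub_eq_zero, map_add, map_one] at hu
    have h := Units.val_zpow_of_sub_one_sq
      (Units.map (Ideal.Quotient.mk J : PowerSeries (valRing v) →* _ ⧸ J) u)
      (by simpa [hu] using hε) n
    rw [← map_zpow] at h
    simpa only [Units.coe_map, MonoidHom.coe_coe, hu, add_sub_cancel_left] using h
  have hQ' := key Q (-X) (by rwa [← sub_eq_add_neg]) (by simpa using hXX) c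
  simp only [map_mul] at hξη hξX hηX
  simp only [map_sub, map_add, map_mul, Units.val_mul, key X₁ ξ hX hξ a, key Y₁ η hY hη b, hQ',
    map_one, map_intCast, map_neg]
  linear_combination ((a : PowerSeries (valRing v) ⧸ J) * b * (1 - c * Ideal.Quotient.mk J X)) *
    hξη - (a * c : PowerSeries (valRing v) ⧸ J) * hξX - (b * c : PowerSeries (valRing v) ⧸ J) * hηX

end Branches

/-! ### Valuation estimates for coefficients along a branch. -/

section Estimate

open PowerSeries

variable {K : Type*} [Field K] {v : AddValuation K (WithTop ℝ)}

theorem nonneg_add_coe_iff {x : WithTop ℝ} {γ : ℝ} :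
    0 ≤ x + (γ : WithTop ℝ) ↔ ((-γ : ℝ) : WithTop ℝ) ≤ x := by
  induction x using WithTop.recTopCoe with
  | top => simp
  | coe x =>
    rw [← WithTop.coe_add, ← WithTop.coe_zero, WithTop.coe_le_coe, WithTop.coe_le_coe]
    constructor <;> intro h <;> linarith

theorem pos_add_coe_iff {x : WithTop ℝ} {γ : ℝ} :
    0 < x + (γ : WithTop ℝ) ↔ ((-γ : ℝ) : WithTop ℝ) < x := by
  induction x using WithTop.recTopCoe with
  | top => exact iff_of_true (by simp) (WithTop.coe_lt_top _)
  | coe x =>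
    rw [← WithTop.coe_add, ← WithTop.coe_zero, WithTop.coe_lt_coe, WithTop.coe_lt_coe]
    constructor <;> intro h <;> linarith

theorem coe_le_val_mul {a b : K} {c d : ℝ} (ha : (c : WithTop ℝ) ≤ v a)
    (hb : (d : WithTop ℝ) ≤ v b) : ((c + d : ℝ) : WithTop ℝ) ≤ v (a * b) := by
  rw [v.map_mul, WithTop.coe_add]
  exact add_le_add ha hb

theorem coe_le_val_pow {a : K} (ha : v a = ((1 : ℝ) : WithTop ℝ)) (n : ℕ) :
    ((n : ℝ) : WithTop ℝ) ≤ v (a ^ n) := by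
  rw [v.map_pow, ha, ← WithTop.coe_nsmul, nsmul_one]

theorem lt_val_of_lt_val_mul {a b : K} (ha : v a = ((1 : ℝ) : WithTop ℝ)) {c : ℝ}
    (h : ((c + 1 : ℝ) : WithTop ℝ) < v (a * b)) : (c : WithTop ℝ) < v b := by
  rw [v.map_mul, ha] at h
  generalize v b = x at *
  induction x using WithTop.recTopCoe with
  | top => simp
  | coe x =>
    rw [← WithTop.coe_add, WithTop.coe_lt_coe] at h
    rw [WithTop.coe_lt_coe]
    linarith

/-- The deviation of a power series from its first order part has large valuation. -/
theorem val_deviation {p : valRing v} (hp : v (p : K) = ((1 : ℝ) : WithTop ℝ))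
    {s : PowerSeries (valRing v)} {a b : valRing v}
    (hs : s - (C a + C b * X) ∈ firstOrderIdeal p) (l : ℕ) :
    ((max 2 (l : ℝ) : ℝ) : WithTop ℝ) ≤ v ((if l = 0 then (a : K) else 0) +
      (if l = 1 then (p : K) * b else 0) - (p : K) ^ l * (coeff l s : valRing v)) := by
  -- The factor `p ^ l` amounts to replacing `X` by `pX`. The generators `p²`, `pX`, `X²` then all
  -- become divisible by `p²`, and degree `l` by `p ^ l`; hence the bound `max 2 l`.
  obtain ⟨s₁, s₂, s₃, h⟩ := mem_firstOrderIdeal.mp hs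
  rw [sub_eq_iff_eq_add] at h
  have hpos : ∀ d : valRing v, ((0 : ℝ) : WithTop ℝ) ≤ v (-(d : K)) := fun d => (-d).2
  rcases l with _ | _ | l
  · have hc : coeff 0 s = coeff 0 s₁ * p ^ 2 + a := by
      rw [h]
      simp
    have : (a : K) - (coeff 0 s : valRing v) = (p : K) ^ 2 * (-(coeff 0 s₁ : valRing v) : K) := by
      rw [hc]
      push_cast
      ring
    simp only [if_true, zero_ne_one, if_false, add_zero, pow_zero, one_mul, this]
    refine le_trans ?_ (coe_le_val_mul (coe_le_val_pow hp 2) (hpos _))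
    norm_num
  · have hc : coeff 1 s = coeff 1 s₁ * p ^ 2 + coeff 0 s₂ * p + b := by
      rw [h, ← map_pow]
      have e1 : s₂ * (C p * X) = C p * s₂ * X ^ 1 := by ring
      have e2 : s₃ * X ^ 2 = s₃ * X * X ^ 1 := by ring
      have e3 : C b * X = C b * (X : PowerSeries (valRing v)) ^ 1 := by ring
      rw [e1, e2, e3]
      simp only [map_add, coeff_mul_C, coeff_mul_X_pow', coeff_C_mul]
      simp [coeff_C]
      ring
    have : (p : K) * b - (p : K) * (coeff 1 s : valRing v) =
        (p : K) ^ 2 * (-((coeff 1 s₁ * p + coeff 0 s₂ : valRing v) : K)) := by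
      rw [hc]
      push_cast
      ring
    simp only [zero_add, one_ne_zero, if_true, if_false, pow_one, this]
    refine le_trans ?_ (coe_le_val_mul (coe_le_val_pow hp 2) (hpos _))
    norm_num
  · have h0 : l + 1 + 1 ≠ 0 := by omega
    have h1 : l + 1 + 1 ≠ 1 := by omega
    rw [if_neg h0, if_neg h1, zero_add, zero_sub, ← mul_neg]
    refine le_trans ?_ (coe_le_val_mul (coe_le_val_pow hp _) (hpos _))
    rw [add_zero, max_eq_right]
    push_cast
    linarith [(Nat.cast_nonneg l : (0 : ℝ) ≤ l)]

/-- The coefficient of `τ ^ n` vanishes along the branch. A monomial with `z`-exponent `n - l`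
contributes its coefficient of degree `l`, so replacing the series by their first-order parts leaves
only `l = 0, 1` and costs an error of valuation at least `-(Z * (n - l)) + max 2 l`. -/
theorem lt_val_sum_of_deviation {p : valRing v} (hp : v (p : K) = ((1 : ℝ) : WithTop ℝ))
    {f : Laurent K 3} {Z : ℝ} (hf : ∀ u, ((-(Z * u 2) : ℝ) : WithTop ℝ) ≤ v (f.coeff u))
    {s : (Fin 3 → ℤ) → PowerSeries (valRing v)} {a b : (Fin 3 → ℤ) → valRing v}
    (hs : ∀ u, s u - (C (a u) + C (b u) * X) ∈ firstOrderIdeal p) {n : ℤ}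
    (hsum : ∑ u ∈ f.coeff.support, f.coeff u * ((p : K) ^ (-u 2) *
      (toLaurentSeries v (s u)).coeff (n - u 2)) = 0) {c : ℝ}
    (hc : ∀ l : ℕ, c < -(Z * (n - l)) + max 2 (l : ℝ)) :
    (c : WithTop ℝ) < v (∑ u ∈ f.coeff.support, f.coeff u *
      ((if u 2 = n then (a u : K) else 0) + (if u 2 = n - 1 then (p : K) * b u else 0))) := by
  have hp0 := ne_zero_of_val hp
  -- Multiplication by `p ^ n` turns the factor `p ^ (-u 2)` from `z = (τ / p)Q` into `p ^ l` with
  -- `l = n - u 2`.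
  have hsum' : ∑ u ∈ f.coeff.support, f.coeff u * ((p : K) ^ (n - u 2) *
      (toLaurentSeries v (s u)).coeff (n - u 2)) = 0 := by
    rw [← mul_zero ((p : K) ^ n), ← hsum, Finset.mul_sum]
    refine Finset.sum_congr rfl fun u _ => ?_
    rw [sub_eq_add_neg, zpow_add₀ hp0]
    ring
  have : ∑ u ∈ f.coeff.support, f.coeff u *
      ((if u 2 = n then (a u : K) else 0) + (if u 2 = n - 1 then (p : K) * b u else 0)) =
      ∑ u ∈ f.coeff.support, f.coeff u *
        ((if u 2 = n then (a u : K) else 0) + (if u 2 = n - 1 then (p : K) * b u else 0) -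
          (p : K) ^ (n - u 2) * (toLaurentSeries v (s u)).coeff (n - u 2)) := by
    simp only [mul_sub, Finset.sum_sub_distrib, hsum', sub_zero]
  rw [this]
  refine v.map_lt_sum (WithTop.coe_ne_top) fun u _ => ?_
  rcases lt_or_ge (n - u 2) 0 with hl | hl
  · rw [toLaurentSeries_coeff_of_neg _ hl, if_neg (by omega), if_neg (by omega)]
    simp
  · obtain ⟨l, hl⟩ := Int.eq_ofNat_of_zero_le hl
    have h0 : u 2 = n ↔ l = 0 := by omega
    have h1 : u 2 = n - 1 ↔ l = 1 := by omega
    rw [hl, toLaurentSeries_coeff_natCast, zpow_natCast]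
    simp only [h0, h1]
    refine lt_of_lt_of_le ?_ (coe_le_val_mul (hf u) (val_deviation hp (hs u) l))
    rw [WithTop.coe_lt_coe]
    have h2 : (u 2 : ℝ) = n - l := by
      have : u 2 = n - l := by omega
      rw [this]
      push_cast
      rfl
    rw [h2]
    exact hc l

end Estimate

/-! ### Estimates for elements of the curve ideal, and the initial ideals. -/

section CurveEstimate

open PowerSeries

variable {K : Type*} [Field K] {v : AddValuation K (WithTop ℝ)} {p : valRing v}
  {f : Laurent K 3} {Z : ℝ}

theorem le_val_zSum (hf : ∀ u, ((-(Z * u 2) : ℝ) : WithTop ℝ) ≤ v (f.coeff u))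
    (c : (Fin 3 → ℤ) → ℤ) (n : ℤ) : ((-(Z * n) : ℝ) : WithTop ℝ) ≤ v (zSum c f n) := by
  refine v.map_le_sum fun u _ => ?_
  split_ifs with h
  · rw [← h]
    have h0 : ((0 : ℝ) : WithTop ℝ) ≤ v ((c u : ℤ) : K) := nonneg_val_intCast _
    simpa using coe_le_val_mul h0 (hf u)
  · simp

theorem sum_mul_ite_eq (f : Laurent K 3) (a b : (Fin 3 → ℤ) → ℤ) (α β : K) (n m : ℤ) :
    ∑ u ∈ f.coeff.support, f.coeff u *
      ((if u 2 = n then (a u : K) * α else 0) + (if u 2 = m then β * (b u : K) else 0)) =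
    α * zSum a f n + β * zSum b f m := by
  rw [zSum, zSum, Finset.mul_sum, Finset.mul_sum, ← Finset.sum_add_distrib]
  refine Finset.sum_congr rfl fun u _ => ?_
  split_ifs <;> ring

/-- The first family evaluates monomials on the second branch. The second family is the difference
of the two branches: they share `Q`, so the constant term and the `z`-exponent cancel and only the
`x`- and `y`-exponents remain to first order. -/
theorem exists_deviation_series (hp : v (p : K) = ((1 : ℝ) : WithTop ℝ))
    (hfI : f ∈ curveIdeal (p : K)) :
    (∃ s : (Fin 3 → ℤ) → PowerSeries (valRing v),
      (∀ u, s u - (C 1 + C (-(u 2 : valRing v)) * X) ∈ firstOrderIdeal p) ∧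
      ∀ n : ℤ, ∑ u ∈ f.coeff.support, f.coeff u * ((p : K) ^ (-u 2) *
        (toLaurentSeries v (s u)).coeff (n - u 2)) = 0) ∧
    ∃ s : (Fin 3 → ℤ) → PowerSeries (valRing v),
      (∀ u, s u - (C ((u 0 : valRing v) * p) + C (u 1 : valRing v) * X) ∈ firstOrderIdeal p) ∧
      ∀ n : ℤ, ∑ u ∈ f.coeff.support, f.coeff u * ((p : K) ^ (-u 2) *
        (toLaurentSeries v (s u)).coeff (n - u 2)) = 0 := by
  have hp0 := ne_zero_of_val hp
  obtain ⟨X₁, Y₁, X₂, Y₂, Q, h1, h2, hX₁, hY₁, hX₂, hY₂, hQ⟩ := exists_branches hp hp0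
  have m1 := monomial_sub_mem (p := p) (ξ := C p) (η := X)
    (mem_firstOrderIdeal.mpr ⟨0, 1, 0, by ring⟩) (mem_firstOrderIdeal.mpr ⟨0, 1, 0, by ring⟩)
    (mem_firstOrderIdeal.mpr ⟨0, 0, 1, by ring⟩) (mem_firstOrderIdeal.mpr ⟨1, 0, 0, by ring⟩)
    (mem_firstOrderIdeal.mpr ⟨0, 0, 1, by ring⟩) hX₁ hY₁ hQ
  have m2 := monomial_sub_mem (p := p) (ξ := 0) (η := 0) (by simp) (by simp) (by simp) (by simp)
    (by simp) (by rwa [add_zero]) (by rwa [add_zero]) hQ (X₁ := X₂) (Y₁ := Y₂)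
  have e1 := fun n => (laurentEval_branchPoint_coeff hp0 X₁ Y₁ Q f n).symm.trans
    (by rw [h1 f hfI, HahnSeries.coeff_zero])
  have e2 := fun n => (laurentEval_branchPoint_coeff hp0 X₂ Y₂ Q f n).symm.trans
    (by rw [h2 f hfI, HahnSeries.coeff_zero])
  refine ⟨⟨fun u => ((X₂ ^ u 0 * Y₂ ^ u 1 * Q ^ u 2 : (PowerSeries (valRing v))ˣ) :
      PowerSeries (valRing v)), fun u => ?_, e2⟩,
    ⟨fun u => ((X₁ ^ u 0 * Y₁ ^ u 1 * Q ^ u 2 : (PowerSeries (valRing v))ˣ) :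
      PowerSeries (valRing v)) - ((X₂ ^ u 0 * Y₂ ^ u 1 * Q ^ u 2 : (PowerSeries (valRing v))ˣ) :
      PowerSeries (valRing v)), fun u => ?_, fun n => ?_⟩⟩
  · convert m2 (u 0) (u 1) (u 2) using 1
    simp only [map_one, map_neg, map_intCast]
    ring
  · convert sub_mem (m1 (u 0) (u 1) (u 2)) (m2 (u 0) (u 1) (u 2)) using 1
    simp only [map_mul, map_intCast]
    ring
  · simp only [map_sub, HahnSeries.coeff_sub, mul_sub, Finset.sum_sub_distrib, e1, e2, sub_zero]

theorem lt_val_zSum_one (hp : v (p : K) = ((1 : ℝ) : WithTop ℝ)) (hfI : f ∈ curveIdeal (p : K))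
    (hf : ∀ u, ((-(Z * u 2) : ℝ) : WithTop ℝ) ≤ v (f.coeff u)) (hZ : -1 < Z) (n : ℤ) :
    ((-(Z * n) : ℝ) : WithTop ℝ) < v (zSum (fun _ => 1) f n) := by
  obtain ⟨⟨s, hs, hsum⟩, -⟩ := exists_deviation_series hp hfI
  have h := lt_val_sum_of_deviation hp hf hs (hsum n) (c := -(Z * n)) fun l => by
    have hl : (0 : ℝ) ≤ l := Nat.cast_nonneg l
    rcases eq_or_lt_of_le hl with h0 | h0
    · rw [← h0]
      norm_num
    · have := le_max_right (2 : ℝ) l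
      nlinarith
  have h' := sum_mul_ite_eq f (fun _ => 1) (fun u => -u 2) 1 (p : K) n (n - 1)
  push_cast at h h'
  simp only [one_mul] at h'
  rw [h'] at h
  -- The contribution from `z`-exponent `n - 1` has valuation at least `1 - Z(n - 1)`, which exceeds
  -- `-Zn` exactly because `Z > -1`.
  have hb : ((-(Z * n) : ℝ) : WithTop ℝ) < v ((p : K) * zSum (fun u => -u 2) f (n - 1)) := by
    refine lt_of_lt_of_le ?_ (coe_le_val_mul hp.ge (le_val_zSum hf (fun u => -u 2) (n - 1)))
    rw [WithTop.coe_lt_coe]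
    push_cast
    linarith
  have h3 := v.map_lt_add h (show _ < v (-((p : K) * zSum (fun u => -u 2) f (n - 1))) by
    rwa [v.map_neg])
  rwa [add_neg_cancel_right] at h3

/-- The difference of the branches carries a common factor `p`. Dividing by it lowers the bound by
one, which is why the hypothesis has `c + 1`. -/
theorem lt_val_zSum_add (hp : v (p : K) = ((1 : ℝ) : WithTop ℝ)) (hfI : f ∈ curveIdeal (p : K))
    (hf : ∀ u, ((-(Z * u 2) : ℝ) : WithTop ℝ) ≤ v (f.coeff u)) {n : ℤ} {c : ℝ}
    (hc : ∀ l : ℕ, c + 1 < -(Z * (n - l)) + max 2 (l : ℝ)) :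
    (c : WithTop ℝ) < v (zSum (fun u => u 0) f n + zSum (fun u => u 1) f (n - 1)) := by
  obtain ⟨-, s, hs, hsum⟩ := exists_deviation_series hp hfI
  have h := lt_val_sum_of_deviation hp hf hs (hsum n) hc
  have h' := sum_mul_ite_eq f (fun u => u 0) (fun u => u 1) (p : K) (p : K) n (n - 1)
  push_cast at h
  rw [h', ← mul_add] at h
  exact lt_val_of_lt_val_mul hp h

/-- For `Z > 0` the `y`-derivative at degree `n - 1` already has valuation above `-Zn`, so the bound
on the sum passes to the `x`-derivative. -/
theorem lt_val_zSum_zero_of_pos (hp : v (p : K) = ((1 : ℝ) : WithTop ℝ))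
    (hfI : f ∈ curveIdeal (p : K))
    (hf : ∀ u, ((-(Z * u 2) : ℝ) : WithTop ℝ) ≤ v (f.coeff u)) (hZ : 0 < Z) (n : ℤ) :
    ((-(Z * n) : ℝ) : WithTop ℝ) < v (zSum (fun u => u 0) f n) := by
  have h := lt_val_zSum_add hp hfI hf (n := n) (c := -(Z * n)) fun l => by
    have hl : (0 : ℝ) ≤ l := Nat.cast_nonneg l
    have := le_max_left (2 : ℝ) l
    nlinarith
  have hb : ((-(Z * n) : ℝ) : WithTop ℝ) < v (-(zSum (fun u => u 1) f (n - 1))) := by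
    rw [v.map_neg]
    refine lt_of_lt_of_le ?_ (le_val_zSum hf (fun u => u 1) (n - 1))
    rw [WithTop.coe_lt_coe]
    push_cast
    linarith
  have h3 := v.map_lt_add h hb
  rwa [add_neg_cancel_right] at h3

theorem lt_val_zSum_one_of_neg (hp : v (p : K) = ((1 : ℝ) : WithTop ℝ))
    (hfI : f ∈ curveIdeal (p : K))
    (hf : ∀ u, ((-(Z * u 2) : ℝ) : WithTop ℝ) ≤ v (f.coeff u)) (hZ : -1 < Z) (hZ' : Z < 0)
    (n : ℤ) : ((-(Z * n) : ℝ) : WithTop ℝ) < v (zSum (fun u => u 1) f n) := by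
  -- The degree is shifted to `n + 1` so that the `y`-derivative appears at degree `n`; for `Z < 0`
  -- the `x`-derivative at degree `n + 1` is then the negligible summand.
  have h := lt_val_zSum_add hp hfI hf (n := n + 1) (c := -(Z * n)) fun l => by
    push_cast
    have h2 := le_max_left (2 : ℝ) l
    have h3 := le_max_right (2 : ℝ) l
    rcases l with _ | _ | l
    · push_cast at *
      linarith
    · push_cast at *
      linarith
    · have hl : (0 : ℝ) ≤ l := Nat.cast_nonneg l
      push_cast at *
      nlinarith
  have hb : ((-(Z * n) : ℝ) : WithTop ℝ) < v (-(zSum (fun u => u 0) f (n + 1))) := by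
    rw [v.map_neg]
    refine lt_of_lt_of_le ?_ (le_val_zSum hf (fun u => u 0) (n + 1))
    rw [WithTop.coe_lt_coe]
    push_cast
    linarith
  have h3 := v.map_lt_add h hb
  rwa [add_neg_cancel_comm, add_sub_cancel_right] at h3

variable (r : Splitting v) {w : Fin 3 → ℝ}

theorem val_coeff_of_mem_tilted (hX : w 0 = 0) (hY : w 1 = 0) (hf : f ∈ tilted v w)
    (u : Fin 3 → ℤ) : ((-(w 2 * u 2) : ℝ) : WithTop ℝ) ≤ v (f.coeff u) := by
  rw [← nonneg_add_coe_iff, ← dot_eq hX hY]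
  exact coeff_of_mem_tilted hf u

theorem initialIdeal_le {I : Ideal (Laurent K 3)} {J : Ideal (Laurent (ResField v) 3)}
    (h : ∀ f ∈ I, f ∈ tilted v w → initialForm r w f ∈ J) : initialIdeal r I w ≤ J := by
  rw [initialIdeal, Ideal.map_le_iff_le_comap]
  intro f hf
  exact h f hf f.2

theorem mem_valRing_of_val {π : K} (hπ : v π = ((1 : ℝ) : WithTop ℝ)) : π ∈ valRing v := by
  rw [mem_valRing, hπ, ← WithTop.coe_zero, WithTop.coe_le_coe]
  exact zero_le_one

theorem initialIdeal_of_neg {π : K} (hp : v π = ((1 : ℝ) : WithTop ℝ)) (hX : w 0 = 0)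
    (hY : w 1 = 0) (hZ : -1 < w 2) (hZ' : w 2 < 0) :
    initialIdeal r (curveIdeal π) w =
      Ideal.span {coord (ResField v) 0 - 1, (coord (ResField v) 1 - 1) ^ 2} := by
  refine le_antisymm (initialIdeal_le r fun f hfI hf => ?_)
    (span_le_initialIdeal_of_neg r hp hX hY hZ hZ')
  have hπ : π ∈ valRing v := mem_valRing_of_val hp
  have hv := val_coeff_of_mem_tilted hX hY hf
  exact initialForm_mem_of_neg r hX hY hf
    (fun n => pos_add_coe_iff.mpr (lt_val_zSum_one (p := ⟨π, hπ⟩) hp hfI hv hZ n))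
    (fun n => pos_add_coe_iff.mpr (lt_val_zSum_one_of_neg (p := ⟨π, hπ⟩) hp hfI hv hZ hZ' n))

theorem initialIdeal_of_zero {π : K} (hp : v π = ((1 : ℝ) : WithTop ℝ)) (hX : w 0 = 0)
    (hY : w 1 = 0) (hZ : w 2 = 0) :
    initialIdeal r (curveIdeal π) w = Ideal.span {(coord (ResField v) 0 - 1) ^ 2,
      (coord (ResField v) 0 - 1) * coord (ResField v) 2 - (coord (ResField v) 1 - 1)} := by
  refine le_antisymm (initialIdeal_le r fun f hfI hf => ?_)
    (span_le_initialIdeal_of_zero r hp hX hY hZ)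
  have hπ : π ∈ valRing v := mem_valRing_of_val hp
  have hv := val_coeff_of_mem_tilted hX hY hf
  refine initialForm_mem_of_zero r hX hY hZ hf
    (fun n => pos_add_coe_iff.mpr (lt_val_zSum_one (p := ⟨π, hπ⟩) hp hfI hv (by rw [hZ]; norm_num) n))
    (fun n => ?_)
  rw [← WithTop.coe_zero]
  refine lt_val_zSum_add (p := ⟨π, hπ⟩) hp hfI hv fun l => ?_
  rw [hZ]
  linarith [le_max_left (2 : ℝ) l]

theorem initialIdeal_of_pos {π : K} (hp : v π = ((1 : ℝ) : WithTop ℝ)) (hX : w 0 = 0)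
    (hY : w 1 = 0) (hZ : 0 < w 2) :
    initialIdeal r (curveIdeal π) w =
      Ideal.span {(coord (ResField v) 0 - 1) ^ 2, coord (ResField v) 1 - 1} := by
  refine le_antisymm (initialIdeal_le r fun f hfI hf => ?_)
    (span_le_initialIdeal_of_pos r hp hX hY hZ)
  have hπ : π ∈ valRing v := mem_valRing_of_val hp
  have hv := val_coeff_of_mem_tilted hX hY hf
  exact initialForm_mem_of_pos r hX hY hf
    (fun n => pos_add_coe_iff.mpr (lt_val_zSum_one (p := ⟨π, hπ⟩) hp hfI hv (by linarith) n))
    (fun n => pos_add_coe_iff.mpr (lt_val_zSum_zero_of_pos (p := ⟨π, hπ⟩) hp hfI hv hZ n))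

end CurveEstimate

/-! ### The three double structures on the subtorus. -/

section Thickenings

variable {k : Type*} [Field k]

/-- The unit `1 + a ε` of the dual numbers. -/
def dualUnit (a : k) : (DualNumber k)ˣ where
  val := 1 + a • DualNumber.eps
  inv := 1 - a • DualNumber.eps
  val_inv := by
    have := DualNumber.eps_mul_eps (R := k)
    rw [Algebra.smul_def]
    linear_combination (-(algebraMap k (DualNumber k) a) ^ 2) * this
  inv_val := by
    have := DualNumber.eps_mul_eps (R := k)
    rw [Algebra.smul_def]
    linear_combination (-(algebraMap k (DualNumber k) a) ^ 2) * this

/-- The tangent vector `(a, b, 0)` at the point `(1, 1, 1)`. -/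
def tangentEval (a b : k) : Laurent k 3 →ₐ[k] DualNumber k :=
  laurentEval ![dualUnit a, dualUnit b, 1]

theorem tangentEval_x (a b : k) : tangentEval a b (coord k 0) = 1 + a • DualNumber.eps :=
  laurentEval_coord _ _

theorem tangentEval_y (a b : k) : tangentEval a b (coord k 1) = 1 + b • DualNumber.eps :=
  laurentEval_coord _ _

theorem tangentEval_z (a b : k) : tangentEval a b (coord k 2) = 1 :=
  laurentEval_coord _ _

variable (k) in
/-- The initial ideal for `-1 < Z < 0`. -/
abbrev negIdeal : Ideal (Laurent k 3) := Ideal.span {coord k 0 - 1, (coord k 1 - 1) ^ 2}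

variable (k) in
/-- The initial ideal for `Z = 0`. -/
abbrev midIdeal : Ideal (Laurent k 3) :=
  Ideal.span {(coord k 0 - 1) ^ 2, (coord k 0 - 1) * coord k 2 - (coord k 1 - 1)}

variable (k) in
/-- The initial ideal for `0 < Z`. -/
abbrev posIdeal : Ideal (Laurent k 3) := Ideal.span {(coord k 0 - 1) ^ 2, coord k 1 - 1}

/-- The tangent vectors `(0, 1)`, `(1, 1)`, `(1, 0)` at `(1, 1, 1)` are tangent to the three schemes
respectively. Their nonzero entries show that `y - 1` or `x - 1` is missing from the ideal, which
gives properness, non-reducedness and the pairwise differences. -/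
theorem negIdeal_le_ker : negIdeal k ≤
    RingHom.ker (tangentEval (0 : k) 1) := by
  rw [Ideal.span_le, Set.pair_subset_iff]
  simp [RingHom.mem_ker, tangentEval_x, tangentEval_y, sq, DualNumber.eps_mul_eps]

theorem midIdeal_le_ker : midIdeal k ≤ RingHom.ker (tangentEval (1 : k) 1) := by
  rw [Ideal.span_le, Set.pair_subset_iff]
  simp [RingHom.mem_ker, tangentEval_x, tangentEval_y, tangentEval_z, sq,
    DualNumber.eps_mul_eps]

theorem posIdeal_le_ker : posIdeal k ≤
    RingHom.ker (tangentEval (1 : k) 0) := by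
  rw [Ideal.span_le, Set.pair_subset_iff]
  simp [RingHom.mem_ker, tangentEval_x, tangentEval_y, sq, DualNumber.eps_mul_eps]

theorem eps_ne_zero : (DualNumber.eps : DualNumber k) ≠ 0 := by
  intro h
  have := congrArg TrivSqZeroExt.snd h
  simp at this

theorem x_sub_one_notMem {J : Ideal (Laurent k 3)} {b : k}
    (hJ : J ≤ RingHom.ker (tangentEval 1 b)) : coord k 0 - 1 ∉ J := by
  intro h
  have := hJ h
  rw [RingHom.mem_ker, map_sub, tangentEval_x] at this
  exact eps_ne_zero (by simpa using this)

theorem y_sub_one_notMem {J : Ideal (Laurent k 3)} {a : k}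
    (hJ : J ≤ RingHom.ker (tangentEval a 1)) : coord k 1 - 1 ∉ J := by
  intro h
  have := hJ h
  rw [RingHom.mem_ker, map_sub, tangentEval_y] at this
  exact eps_ne_zero (by simpa using this)

theorem negIdeal_ne_midIdeal : negIdeal k ≠
    midIdeal k := fun h =>
  x_sub_one_notMem midIdeal_le_ker
    (h.le (Ideal.subset_span (by simp)))

theorem midIdeal_ne_posIdeal :
    midIdeal k ≠
    posIdeal k := fun h =>
  y_sub_one_notMem midIdeal_le_ker
    (h.ge (Ideal.subset_span (by simp)))

theorem negIdeal_ne_posIdeal : negIdeal k ≠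
    posIdeal k := fun h =>
  x_sub_one_notMem posIdeal_le_ker
    (h.le (Ideal.subset_span (by simp)))

theorem not_isRadical_of_sq_mem {R : Type*} [CommRing R] {J : Ideal R} {a : R} (h : a ^ 2 ∈ J)
    (ha : a ∉ J) : ¬ J.IsRadical := fun hJ => ha (hJ ⟨2, h⟩)

theorem zeroLocus_negIdeal : PrimeSpectrum.zeroLocus
    ((negIdeal k : Ideal (Laurent k 3)) : Set (Laurent k 3)) =
      PrimeSpectrum.zeroLocus {coord k 0 - 1, coord k 1 - 1} := by
  rw [PrimeSpectrum.zeroLocus_span]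
  ext P
  simp only [PrimeSpectrum.mem_zeroLocus, Set.pair_subset_iff, SetLike.mem_coe,
    P.isPrime.pow_mem_iff_mem 2 two_pos]

theorem zeroLocus_posIdeal : PrimeSpectrum.zeroLocus
    ((posIdeal k : Ideal (Laurent k 3)) : Set (Laurent k 3)) =
      PrimeSpectrum.zeroLocus {coord k 0 - 1, coord k 1 - 1} := by
  rw [PrimeSpectrum.zeroLocus_span]
  ext P
  simp only [PrimeSpectrum.mem_zeroLocus, Set.pair_subset_iff, SetLike.mem_coe,
    P.isPrime.pow_mem_iff_mem 2 two_pos]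

theorem zeroLocus_midIdeal : PrimeSpectrum.zeroLocus
    ((midIdeal k : Ideal (Laurent k 3)) : Set (Laurent k 3)) = PrimeSpectrum.zeroLocus {coord k 0 - 1, coord k 1 - 1} := by
  rw [PrimeSpectrum.zeroLocus_span]
  ext P
  simp only [PrimeSpectrum.mem_zeroLocus, Set.pair_subset_iff, SetLike.mem_coe,
    P.isPrime.pow_mem_iff_mem 2 two_pos]
  refine and_congr_right fun h => ?_
  exact Submodule.sub_mem_iff_right _ (Ideal.mul_mem_right _ _ h)

end Thickenings

/-! ### Components of loci, and the ray as a topological stratum. -/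

section Strata

open Filter Topology

/-- `C` is cut out of `F` both by an open and by a closed set, so it is clopen in `F`; being
preconnected as well, it is a component. -/
theorem connectedComponentIn_eq_of_clopen {α : Type*} [TopologicalSpace α] {F C D O : Set α}
    {x : α} (hx : x ∈ C) (hC : IsPreconnected C) (hO : IsOpen O) (hD : IsClosed D)
    (hFO : F ∩ O = C) (hFD : F ∩ D = C) : connectedComponentIn F x = C := by
  have hCF : C ⊆ F := hFO ▸ Set.inter_subset_left
  refine Set.Subset.antisymm (fun y hy => ?_) (hC.subset_connectedComponentIn hx hCF)
  by_contra hyC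
  have hS := connectedComponentIn_subset F x
  have hcover : connectedComponentIn F x ⊆ O ∪ Dᶜ := by
    intro z hz
    by_cases hzD : z ∈ D
    · have : z ∈ C := hFD ▸ ⟨hS hz, hzD⟩
      rw [← hFO] at this
      exact Or.inl this.2
    · exact Or.inr hzD
  obtain ⟨z, hz, hzO, hzD⟩ := isPreconnected_connectedComponentIn O Dᶜ hO hD.isOpen_compl
    hcover ⟨x, mem_connectedComponentIn (hCF hx), (hFO.symm ▸ hx : x ∈ F ∩ O).2⟩
    ⟨y, hy, fun hyD => hyC (hFD ▸ ⟨hS hy, hyD⟩)⟩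
  have : z ∈ C := hFO ▸ ⟨hS hz, hzO⟩
  rw [← hFD] at this
  exact hzD this.2

/-- The splitting of `ℝ³` into the first two coordinates and the third. -/
def splitThird : (Fin 3 → ℝ) ≃ₗ[ℝ] (Fin 2 → ℝ) × (Fin 1 → ℝ) where
  toFun w := (![w 0, w 1], ![w 2])
  invFun q := ![q.1 0, q.1 1, q.2 0]
  map_add' w w' := by
    ext i <;> fin_cases i <;> rfl
  map_smul' a w := by
    ext i <;> fin_cases i <;> rfl
  left_inv w := by
    ext i
    fin_cases i <;> rfl
  right_inv q := by
    ext i <;> fin_cases i <;> rfl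

/-- The open half-ray `X = Y = 0`, `Z > -1`. -/
def openRay : Set (Fin 3 → ℝ) := {w | w 0 = 0 ∧ w 1 = 0 ∧ -1 < w 2}

/-- Since `W` is open, `T` contains short segments in the direction `d = q - p` at both points. Near
`p` the set `T` is the ray, so `d` is parallel to the axis, and `q` lies on the axis. -/
theorem mem_openRay_of_mem_fiber {T : Set (Fin 3 → ℝ)} (hT : T ∩ {w | -1 < w 2} = openRay)
    (hT' : ∀ w ∈ T, w 0 = 0 → w 1 = 0 → -1 ≤ w 2) {n m : ℕ}
    {e : (Fin 3 → ℝ) ≃ₗ[ℝ] (Fin n → ℝ) × (Fin m → ℝ)} {U : Set (Fin 3 → ℝ)}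
    {A : Set (Fin n → ℝ)} {W : Set (Fin m → ℝ)} (hW : IsOpen W) (hA : e '' (U ∩ T) = A ×ˢ W)
    {p q : Fin 3 → ℝ} (hpU : p ∈ U) (hqU : q ∈ U) (hpT : p ∈ T) (hqT : q ∈ T)
    (hpq : (e p).1 = (e q).1) (hp : p ∈ openRay) : q ∈ openRay := by
  set d := q - p with hd
  have hed : e d = (0, (e q).2 - (e p).2) := by
    rw [hd, map_sub]
    ext1
    · simp [hpq]
    · simp
  have hmem : ∀ s ∈ U, s ∈ T → ∀ t : ℝ, (e s).2 + t • (e d).2 ∈ W → s + t • d ∈ T := by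
    intro s hsU hsT t ht
    have h1 : e s ∈ A ×ˢ W := hA ▸ Set.mem_image_of_mem e ⟨hsU, hsT⟩
    have h2 : e (s + t • d) ∈ A ×ˢ W := by
      rw [map_add, map_smul]
      refine ⟨?_, ht⟩
      rw [hed]
      simpa using h1.1
    rw [← hA] at h2
    obtain ⟨s', hs', h⟩ := h2
    rw [← e.injective h]
    exact hs'.2
  have hev : ∀ s ∈ U, s ∈ T → ∀ᶠ t : ℝ in 𝓝[>] 0, s + t • d ∈ T := by
    intro s hsU hsT
    have h1 : e s ∈ A ×ˢ W := hA ▸ Set.mem_image_of_mem e ⟨hsU, hsT⟩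
    have hc : Continuous fun t : ℝ => (e s).2 + t • (e d).2 := by fun_prop
    have h2 : ∀ᶠ t : ℝ in 𝓝 0, (e s).2 + t • (e d).2 ∈ W :=
      hc.continuousAt.eventually_mem (hW.mem_nhds (by simpa using h1.2))
    filter_upwards [h2.filter_mono nhdsWithin_le_nhds] with t ht using hmem s hsU hsT t ht
  have hpZ : ∀ᶠ t : ℝ in 𝓝[>] 0, -1 < (p + t • d) 2 := by
    have hc : Continuous fun t : ℝ => (p + t • d) 2 := by
      simp only [Pi.add_apply, Pi.smul_apply]
      fun_prop
    exact (hc.continuousAt.eventually_mem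
      (isOpen_Ioi.mem_nhds (by simpa using hp.2.2))).filter_mono nhdsWithin_le_nhds
  obtain ⟨t, ⟨htT, htZ⟩, ht0⟩ := (((hev p hpU hpT).and hpZ).and self_mem_nhdsWithin).exists
  have htray : p + t • d ∈ openRay := hT ▸ ⟨htT, htZ⟩
  have ht0' : t ≠ 0 := ne_of_gt ht0
  have hq0 : q 0 = 0 := by
    have := htray.1
    simpa [hd, hp.1, ht0'] using this
  have hq1 : q 1 = 0 := by
    have := htray.2.1
    simpa [hd, hp.2.1, ht0'] using this
  -- If `q` were the endpoint, `d` would point downwards and `T` would contain axis points below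
  -- height `-1`.
  refine ⟨hq0, hq1, lt_of_le_of_ne (hT' q hqT hq0 hq1) fun hq2 => ?_⟩
  obtain ⟨t, htT, ht0⟩ := ((hev q hqU hqT).and self_mem_nhdsWithin).exists
  have ht0 : 0 < t := ht0
  have hp0 := hp.1
  have hp1 := hp.2.1
  have hp2 := hp.2.2
  have := hT' _ htT (by simp [hd, hq0, hp0]) (by simp [hd, hq1, hp1])
  simp only [hd, Pi.add_apply, Pi.smul_apply, Pi.sub_apply, smul_eq_mul, ← hq2] at this
  nlinarith

/-- The ray lies in one class because `T` is a product over the half-space `Z > -1`. The class is no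
larger because the partition into the ray and its complement is compatible and the topological
stratification refines it. -/
theorem openRay_mem_topologicalStrata {T : Set (Fin 3 → ℝ)}
    (hT : T ∩ {w | -1 < w 2} = openRay) (hT' : ∀ w ∈ T, w 0 = 0 → w 1 = 0 → -1 ≤ w 2) :
    openRay ∈ topologicalStrata T := by
  have hray : ∀ w ∈ openRay, w ∈ T := fun w hw => (hT.symm ▸ hw : w ∈ T ∩ {w | -1 < w 2}).1
  have h0 : (0 : Fin 3 → ℝ) ∈ openRay := ⟨rfl, rfl, by simp⟩
  let s : Setoid T := Setoid.ker fun p => (p : Fin 3 → ℝ) ∈ openRay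
  have hs : IsProductCompatible T s := by
    rw [isProductCompatible_iff]
    intro n m e U A W _ hW _ hA p q hp hq hpq
    exact propext ⟨mem_openRay_of_mem_fiber hT hT' hW hA hp hq p.2 q.2 hpq,
      mem_openRay_of_mem_fiber hT hT' hW hA hq hp q.2 p.2 hpq.symm⟩
  refine ⟨_, Setoid.mem_classes _ ⟨0, hray 0 h0⟩, Set.Subset.antisymm (fun w hw => ?_) ?_⟩
  · refine ⟨⟨w, hray w hw⟩, ?_, rfl⟩
    refine (isProductCompatible_iff T _).mp (isLeast_topologicalStratification T).1 2 1 splitThird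
      {w | -1 < w 2} {0} {b | -1 < b 0} (isOpen_lt (by fun_prop) (by fun_prop))
      (isOpen_lt (by fun_prop) (by fun_prop)) ?_ ?_ _ _ hw.2.2 h0.2.2 ?_
    · refine Convex.isPreconnected ?_
      exact convex_halfSpace_gt (f := fun b : Fin 1 → ℝ => b 0) ⟨fun _ _ => rfl, fun _ _ => rfl⟩ _
    · rw [Set.inter_comm, hT]
      ext ⟨a, b⟩
      constructor
      · rintro ⟨w, ⟨hx, hy, hz⟩, h⟩
        rw [← h]
        refine ⟨?_, hz⟩
        change ![w 0, w 1] = 0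
        rw [hx, hy]
        ext i
        fin_cases i <;> rfl
      · rintro ⟨ha, hb⟩
        rw [Set.mem_singleton_iff] at ha
        change a = 0 at ha
        refine ⟨splitThird.symm (a, b), ?_, LinearEquiv.apply_symm_apply _ _⟩
        subst ha
        exact ⟨rfl, rfl, hb⟩
    · change ![w 0, w 1] = ![0, 0]
      rw [hw.1, hw.2.1]
  · rintro _ ⟨x, hx, rfl⟩
    have h : s x ⟨0, hray 0 h0⟩ := (isLeast_topologicalStratification T).2 hs hx
    exact h.mpr h0

end Strata

/-! ### Tropicalization and Gröbner strata of the curve. -/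

section Main

variable {K : Type*} [Field K] {v : AddValuation K (WithTop ℝ)} (r : Splitting v) {π : K}
  {w : Fin 3 → ℝ}

theorem negIdeal_ne_top (k : Type*) [Field k] : negIdeal k ≠ ⊤ := fun h =>
  y_sub_one_notMem negIdeal_le_ker (h ▸ Submodule.mem_top)

theorem midIdeal_ne_top (k : Type*) [Field k] : midIdeal k ≠ ⊤ := fun h =>
  x_sub_one_notMem midIdeal_le_ker (h ▸ Submodule.mem_top)

theorem posIdeal_ne_top (k : Type*) [Field k] : posIdeal k ≠ ⊤ := fun h =>
  x_sub_one_notMem posIdeal_le_ker (h ▸ Submodule.mem_top)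

theorem trop_inter_eq_openRay (hπ : v π = ((1 : ℝ) : WithTop ℝ)) :
    Trop r (curveIdeal π) ∩ {w | -1 < w 2} = openRay := by
  ext w
  constructor
  · rintro ⟨hw, hZ⟩
    refine ⟨?_, ?_, hZ⟩
    · by_contra hX
      exact hw (initialIdeal_eq_top_of_coord_zero_ne r hπ hZ hX)
    · by_contra hY
      exact hw (initialIdeal_eq_top_of_coord_one_ne r hπ hZ hY)
  · rintro ⟨hX, hY, hZ⟩
    refine ⟨?_, hZ⟩
    change initialIdeal r (curveIdeal π) w ≠ ⊤
    rcases lt_trichotomy (w 2) 0 with h | h | h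
    · rw [initialIdeal_of_neg r hπ hX hY hZ h]
      exact negIdeal_ne_top _
    · rw [initialIdeal_of_zero r hπ hX hY h]
      exact midIdeal_ne_top _
    · rw [initialIdeal_of_pos r hπ hX hY h]
      exact posIdeal_ne_top _

theorem neg_one_le_of_mem_trop (hπ : v π = ((1 : ℝ) : WithTop ℝ))
    (hw : w ∈ Trop r (curveIdeal π)) (hY : w 1 = 0) : -1 ≤ w 2 := by
  by_contra h
  exact hw (initialIdeal_eq_top_of_lt_neg_one r hπ (not_le.mp h) hY)

theorem mem_openRay_of_initialIdeal_eq (hπ : v π = ((1 : ℝ) : WithTop ℝ))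
    {J : Ideal (Laurent (ResField v) 3)} (hJ : J ≠ ⊤) (h : initialIdeal r (curveIdeal π) w = J)
    (hZ : -1 < w 2) : w ∈ openRay := by
  rw [← trop_inter_eq_openRay r hπ]
  exact ⟨fun h' => hJ (h.symm.trans h'), hZ⟩

/-- The part of the third coordinate axis over a set of heights. -/
def axisPart (s : Set ℝ) : Set (Fin 3 → ℝ) := {w | w 0 = 0 ∧ w 1 = 0 ∧ w 2 ∈ s}

theorem isPreconnected_axisPart {s : Set ℝ} (hs : IsPreconnected s) :
    IsPreconnected (axisPart s) := by
  have : axisPart s = (fun t : ℝ => (![0, 0, t] : Fin 3 → ℝ)) '' s := by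
    ext w
    constructor
    · rintro ⟨h0, h1, h2⟩
      refine ⟨w 2, h2, ?_⟩
      ext i
      fin_cases i
      · exact h0.symm
      · exact h1.symm
      · rfl
    · rintro ⟨t, ht, rfl⟩
      exact ⟨rfl, rfl, ht⟩
  rw [this]
  refine hs.image _ (Continuous.continuousOn ?_)
  refine continuous_pi fun i => ?_
  fin_cases i
  · exact continuous_const
  · exact continuous_const
  · exact continuous_id

theorem isClosed_axisPart {s : Set ℝ} (hs : IsClosed s) : IsClosed (axisPart s) :=
  (isClosed_eq (continuous_apply 0) continuous_const).inter
    ((isClosed_eq (continuous_apply 1) continuous_const).inter (hs.preimage (continuous_apply 2)))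

/-- The component of the locus with initial ideal `J` is the part of the axis over the heights `s`
if these are all the heights above `-1`, and the only ones in a closed set `t` of heights. -/
theorem component_eq_axisPart (hπ : v π = ((1 : ℝ) : WithTop ℝ))
    {J : Ideal (Laurent (ResField v) 3)} (hJ : J ≠ ⊤) {s t : Set ℝ} (hs : IsPreconnected s)
    (hst : s ⊆ t) (ht : IsClosed t) (hs1 : s ⊆ Set.Ioi (-1))
    (h1 : ∀ w ∈ axisPart s, initialIdeal r (curveIdeal π) w = J)
    (h2 : ∀ w ∈ openRay, initialIdeal r (curveIdeal π) w = J → w 2 ∈ s)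
    (h3 : ∀ w ∈ axisPart t, initialIdeal r (curveIdeal π) w = J → w 2 ∈ s)
    (hw : w ∈ axisPart s) :
    connectedComponentIn {w' | initialIdeal r (curveIdeal π) w' = initialIdeal r (curveIdeal π) w}
      w = axisPart s := by
  rw [h1 w hw]
  refine connectedComponentIn_eq_of_clopen (O := {w | -1 < w 2}) (D := axisPart t) hw
    (isPreconnected_axisPart hs) (isOpen_lt continuous_const (continuous_apply 2))
    (isClosed_axisPart ht) ?_ ?_
  · ext w'
    constructor
    · rintro ⟨h, hZ⟩
      have hr := mem_openRay_of_initialIdeal_eq r hπ hJ h hZ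
      exact ⟨hr.1, hr.2.1, h2 w' hr h⟩
    · intro h
      exact ⟨h1 w' h, hs1 h.2.2⟩
  · ext w'
    constructor
    · rintro ⟨h, ht⟩
      exact ⟨ht.1, ht.2.1, h3 w' ht h⟩
    · intro h
      exact ⟨h1 w' h, h.1, h.2.1, hst h.2.2⟩

theorem height_mem_of_initialIdeal_eq (hπ : v π = ((1 : ℝ) : WithTop ℝ)) (hw : w ∈ openRay) :
    (initialIdeal r (curveIdeal π) w = negIdeal (ResField v) → w 2 ∈ Set.Ioo (-1 : ℝ) 0) ∧
    (initialIdeal r (curveIdeal π) w = midIdeal (ResField v) → w 2 ∈ ({0} : Set ℝ)) ∧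
    (initialIdeal r (curveIdeal π) w = posIdeal (ResField v) → w 2 ∈ Set.Ioi (0 : ℝ)) := by
  obtain ⟨hX, hY, hZ⟩ := hw
  rcases lt_trichotomy (w 2) 0 with h | h | h
  · rw [initialIdeal_of_neg r hπ hX hY hZ h]
    exact ⟨fun _ => ⟨hZ, h⟩, fun h' => (negIdeal_ne_midIdeal h').elim,
      fun h' => (negIdeal_ne_posIdeal h').elim⟩
  · rw [initialIdeal_of_zero r hπ hX hY h]
    exact ⟨fun h' => (negIdeal_ne_midIdeal h'.symm).elim, fun _ => h,
      fun h' => (midIdeal_ne_posIdeal h').elim⟩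
  · rw [initialIdeal_of_pos r hπ hX hY h]
    exact ⟨fun h' => (negIdeal_ne_posIdeal h'.symm).elim,
      fun h' => (midIdeal_ne_posIdeal h'.symm).elim, fun _ => h⟩

theorem component_neg (hπ : v π = ((1 : ℝ) : WithTop ℝ)) (hw : w ∈ axisPart (Set.Ioo (-1) 0)) :
    connectedComponentIn {w' | initialIdeal r (curveIdeal π) w' = initialIdeal r (curveIdeal π) w}
      w = axisPart (Set.Ioo (-1) 0) := by
  have h2 : ∀ w ∈ openRay, initialIdeal r (curveIdeal π) w = negIdeal (ResField v) →
    w 2 ∈ Set.Ioo (-1 : ℝ) 0 := fun w hw => (height_mem_of_initialIdeal_eq r hπ hw).1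
  refine component_eq_axisPart r hπ (negIdeal_ne_top _) isPreconnected_Ioo (t := Set.Ici (-1))
    (fun x hx => hx.1.le) isClosed_Ici (fun x hx => hx.1)
    (fun w h => initialIdeal_of_neg r hπ h.1 h.2.1 h.2.2.1 h.2.2.2) h2 (fun w hw h => ?_) hw
  obtain ⟨hX, hY, hZ⟩ := hw
  rcases eq_or_lt_of_le (show -1 ≤ w 2 from hZ) with hZ' | hZ'
  · refine (not_initialIdeal_le_ker r hπ (tangentEval (0 : ResField v) 0 :
      Laurent (ResField v) 3 →+* DualNumber (ResField v)) ?_ hY hZ'.symm ?_).elim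
    · rw [RingHom.coe_coe, tangentEval_y, zero_smul, add_zero]
    · rw [h, Ideal.span_le, Set.pair_subset_iff]
      simp [RingHom.mem_ker, tangentEval_x, tangentEval_y]
  · exact h2 w ⟨hX, hY, hZ'⟩ h

theorem component_zero (hπ : v π = ((1 : ℝ) : WithTop ℝ)) (hw : w ∈ axisPart {0}) :
    connectedComponentIn {w' | initialIdeal r (curveIdeal π) w' = initialIdeal r (curveIdeal π) w}
      w = axisPart {0} :=
  component_eq_axisPart r hπ (midIdeal_ne_top _) isPreconnected_singleton subset_rfl
    isClosed_singleton (by simp) (fun _ h => initialIdeal_of_zero r hπ h.1 h.2.1 h.2.2)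
    (fun _ hw => (height_mem_of_initialIdeal_eq r hπ hw).2.1) (fun _ hw _ => hw.2.2) hw

theorem component_pos (hπ : v π = ((1 : ℝ) : WithTop ℝ)) (hw : w ∈ axisPart (Set.Ioi 0)) :
    connectedComponentIn {w' | initialIdeal r (curveIdeal π) w' = initialIdeal r (curveIdeal π) w}
      w = axisPart (Set.Ioi 0) := by
  have h2 : ∀ w ∈ openRay, initialIdeal r (curveIdeal π) w = posIdeal (ResField v) →
    w 2 ∈ Set.Ioi (0 : ℝ) := fun w hw => (height_mem_of_initialIdeal_eq r hπ hw).2.2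
  refine component_eq_axisPart r hπ (posIdeal_ne_top _) isPreconnected_Ioi (t := Set.Ici 0)
    Set.Ioi_subset_Ici_self isClosed_Ici (Set.Ioi_subset_Ioi (by norm_num))
    (fun w h => initialIdeal_of_pos r hπ h.1 h.2.1 h.2.2) h2 (fun w hw h => ?_) hw
  obtain ⟨hX, hY, hZ⟩ := hw
  exact h2 w ⟨hX, hY, lt_of_lt_of_le (by norm_num) hZ⟩ h

theorem grobnerStrata_meeting_openRay (hπ : v π = ((1 : ℝ) : WithTop ℝ)) :
    {S ∈ grobnerStrata r (curveIdeal π) | (S ∩ openRay).Nonempty} =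
      {axisPart (Set.Ioo (-1) 0), axisPart {0}, axisPart (Set.Ioi 0)} := by
  have key : ∀ {s : Set ℝ} (a : ℝ), a ∈ s → -1 < a → (∀ w ∈ axisPart s, connectedComponentIn
      {w' | initialIdeal r (curveIdeal π) w' = initialIdeal r (curveIdeal π) w} w = axisPart s) →
      axisPart s ∈ grobnerStrata r (curveIdeal π) ∧ (axisPart s ∩ openRay).Nonempty := by
    intro s a ha ha1 h
    have hm : ![0, 0, a] ∈ axisPart s := ⟨rfl, rfl, ha⟩
    have hr : ![0, 0, a] ∈ openRay := ⟨rfl, rfl, ha1⟩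
    refine ⟨⟨![0, 0, a], ?_, (h _ hm).symm⟩, ![0, 0, a], hm, hr⟩
    rw [← trop_inter_eq_openRay r hπ] at hr
    exact hr.1
  ext S
  constructor
  · rintro ⟨⟨w, hw, rfl⟩, p, hp, hX, hY, hZ⟩
    have hpw : initialIdeal r (curveIdeal π) p = initialIdeal r (curveIdeal π) w :=
      connectedComponentIn_subset
        {w' | initialIdeal r (curveIdeal π) w' = initialIdeal r (curveIdeal π) w} w hp
    -- The base point `w` may lie off the ray; the component is rebased at the point `p` where it
    -- meets the ray.
    rw [connectedComponentIn_eq hp, ← hpw]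
    rcases lt_trichotomy (p 2) 0 with h | h | h
    · exact Or.inl (component_neg r hπ ⟨hX, hY, hZ, h⟩)
    · exact Or.inr (Or.inl (component_zero r hπ ⟨hX, hY, h⟩))
    · exact Or.inr (Or.inr (component_pos r hπ ⟨hX, hY, h⟩))
  · rintro (rfl | rfl | rfl)
    · exact key (-1 / 2) (by norm_num) (by norm_num) fun w hw => component_neg r hπ hw
    · exact key 0 rfl (by norm_num) fun w hw => component_zero r hπ hw
    · exact key 1 (Set.mem_Ioi.mpr one_pos) (by norm_num) fun w hw => component_pos r hπ hw

theorem support_and_not_isRadical (hπ : v π = ((1 : ℝ) : WithTop ℝ)) (hw : w ∈ openRay) :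
    PrimeSpectrum.zeroLocus
      (initialIdeal r (curveIdeal π) w : Set (Laurent (ResField v) 3)) =
        PrimeSpectrum.zeroLocus {coord (ResField v) 0 - 1, coord (ResField v) 1 - 1} ∧
      ¬ (initialIdeal r (curveIdeal π) w).IsRadical := by
  obtain ⟨hX, hY, hZ⟩ := hw
  rcases lt_trichotomy (w 2) 0 with h | h | h
  · rw [initialIdeal_of_neg r hπ hX hY hZ h]
    exact ⟨zeroLocus_negIdeal, not_isRadical_of_sq_mem (Ideal.subset_span (by simp))
      (y_sub_one_notMem negIdeal_le_ker)⟩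
  · rw [initialIdeal_of_zero r hπ hX hY h]
    exact ⟨zeroLocus_midIdeal, not_isRadical_of_sq_mem (Ideal.subset_span (by simp))
      (x_sub_one_notMem midIdeal_le_ker)⟩
  · rw [initialIdeal_of_pos r hπ hX hY h]
    exact ⟨zeroLocus_posIdeal, not_isRadical_of_sq_mem (Ideal.subset_span (by simp))
      (x_sub_one_notMem posIdeal_le_ker)⟩

end Main

end TropGrobner
end

open TropGrobner in
theorem mainTheorem6 {K : Type*} [Field K] (v : AddValuation K (WithTop ℝ)) (r : Splitting v)
    (π : K) (hπ : v π = ((1 : ℝ) : WithTop ℝ)) :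
    let I : Ideal (Laurent K 3) := curveIdeal π
    let x : Laurent (ResField v) 3 := coord (ResField v) 0
    let y : Laurent (ResField v) 3 := coord (ResField v) 1
    let z : Laurent (ResField v) 3 := coord (ResField v) 2
    let ray : Set (Fin 3 → ℝ) := {w | w 0 = 0 ∧ w 1 = 0 ∧ -1 < w 2}
    -- `V` is an integral curve
    (I.IsPrime ∧ ringKrullDim (Laurent K 3 ⧸ I) = 1) ∧
    -- the part of the tropicalization in the half-space `Z > -1` is a single open half-ray
    Trop r I ∩ {w | -1 < w 2} = ray ∧
    -- the half-ray is one topological stratum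
    ray ∈ topologicalStrata (Trop r I) ∧
    -- the Gröbner strata that meet the half-ray are exactly three subsets of it
    {S ∈ grobnerStrata r I | (S ∩ ray).Nonempty} =
      {{w | w 0 = 0 ∧ w 1 = 0 ∧ -1 < w 2 ∧ w 2 < 0},
       {w | w 0 = 0 ∧ w 1 = 0 ∧ w 2 = 0},
       {w | w 0 = 0 ∧ w 1 = 0 ∧ 0 < w 2}} ∧
    -- the three initial ideals
    (∀ Z : ℝ, -1 < Z → Z < 0 →
      initialIdeal r I ![0, 0, Z] = Ideal.span {x - 1, (y - 1) ^ 2}) ∧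
    initialIdeal r I ![0, 0, 0] = Ideal.span {(x - 1) ^ 2, (x - 1) * z - (y - 1)} ∧
    (∀ Z : ℝ, 0 < Z →
      initialIdeal r I ![0, 0, Z] = Ideal.span {(x - 1) ^ 2, y - 1}) ∧
    -- all of them have the support `x = y = 1` and are non-reduced
    (∀ w ∈ ray,
      PrimeSpectrum.zeroLocus (initialIdeal r I w : Set (Laurent (ResField v) 3)) =
        PrimeSpectrum.zeroLocus {x - 1, y - 1} ∧
      ¬ (initialIdeal r I w).IsRadical) ∧
    -- the three non-reduced structures are pairwise different
    Ideal.span {x - 1, (y - 1) ^ 2} ≠ Ideal.span {(x - 1) ^ 2, (x - 1) * z - (y - 1)} ∧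
    Ideal.span {(x - 1) ^ 2, (x - 1) * z - (y - 1)} ≠ Ideal.span {(x - 1) ^ 2, y - 1} ∧
    Ideal.span {x - 1, (y - 1) ^ 2} ≠ Ideal.span {(x - 1) ^ 2, y - 1} := by
  intro I x y z ray
  exact ⟨curveIdeal_isPrime_and_ringKrullDim (ne_zero_of_val hπ) (removedPoly_eval_ne_zero v hπ),
    trop_inter_eq_openRay r hπ,
    openRay_mem_topologicalStrata (trop_inter_eq_openRay r hπ)
      fun _ hw _ hY => neg_one_le_of_mem_trop r hπ hw hY,
    grobnerStrata_meeting_openRay r hπ,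
    fun _ h h' => initialIdeal_of_neg r hπ rfl rfl h h',
    initialIdeal_of_zero r hπ rfl rfl rfl,
    fun _ h => initialIdeal_of_pos r hπ rfl rfl h,
    fun _ hw => support_and_not_isRadical r hπ hw,
    negIdeal_ne_midIdeal, midIdeal_ne_posIdeal, negIdeal_ne_posIdeal⟩
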